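/- Let $G$ be a finite group and $k$ a real closed field. A $G$-algebra is a $k$-algebra with an action of $G$ by $k$-algebra automorphisms; $\simeq$ is $G$-equivariant isomorphism of $k$-algebras, and $\mathrm{Aut}_G(A)$ is the group of $G$-equivariant $k$-algebra automorphisms of $A$. A $G$-algebra $A$ is a $G$-Galois algebra if it is faithfully flat over $k$, $A^G=k$, and $A\otimes_k A\to\prod_{g\in G}A$, $x\otimes y\mapsto (x\,(g\cdot y))_g$, is bijective. For a subgroup $S\le G$ and an $S$-algebra $B$, $\mathrm{Ind}_S^G(B)=\{r:G\to B\mid r(sg)=s\cdot r(g)\ \forall s\in S,\,g\in G\}$ with $(g\cdot r)(x)=r(xg)$. Write ${}^gx=gxg^{-1}$. All cochains are normalized (they take the value $1$ as soon as one argument is $1$). For a group $N$, a 2-cocycle $\sigma\in Z^2(N,K^*)$ is a map with $\sigma(x,y)\sigma(xy,z)=\sigma(y,z)\sigma(x,yz)$ (trivial action); it is non-degenerate if $1$ is the only $s\in N$ with $\sigma(s,t)=\sigma(t,s)$ for all $t\in C_N(s)$; and $K_\sigma[N]$ is the twisted group algebra with $K$-basis $(u_x)_{x\in N}$ and $u_xu_y=\sigma(x,y)u_{xy}$.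 A Galois datum for $G$ is $(S,K,N,\sigma,\gamma)$, where $N\trianglelefteq S\le G$; $K/k$ is a Galois extension with a given identification $S/N\cong\mathrm{Gal}(K|k)$, $g\mapsto\bar g$; $\mathrm{char}(k)\nmid|N|$; $\sigma\in Z^2(N,K^*)$ is non-degenerate; and $\gamma:S\times N\to K^*$ satisfies, for $g,h\in S$ and $x,y\in N$, $\bar g(\sigma(x,y))\gamma(g,xy)=\sigma({}^gx,{}^gy)\gamma(g,x)\gamma(g,y)$, $\gamma(gh,x)=\bar g(\gamma(h,x))\gamma(g,{}^hx)$, and $\gamma|_{N\times N}=\gamma_\sigma$ with $\gamma_\sigma(x,y):=\sigma(x,y)\sigma(xy,x^{-1})\sigma(x,x^{-1})^{-1}$. $A(K_\sigma[N],\gamma)$ denotes $K_\sigma[N]$ with the $S$-action $g\cdot(\alpha u_x)=\bar g(\alpha)\gamma(g,x)u_{{}^gx}$. Two such pairs $(\sigma,\gamma)$, $(\sigma',\gamma')$ have the same class in $H^2_S(N,U)$, for an $S$-stable $U\le K^*$ containing their values, if there is $\eta:N\to U$ with $\sigma'(x,y)/\sigma(x,y)=\eta(x)\eta(y)/\eta(xy)$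 and $\gamma'(g,x)/\gamma(g,x)=\bar g(\eta(x))/\eta({}^gx)$. Equality of classes of $\sigma,\sigma'$ in $H^2(N,U)$ means the first of these two equations alone, for some $\eta:N\to U$. For $g\in G$ put $\sigma^g(x,y)=\sigma({}^gx,{}^gy)$ and $\gamma^g(s,x)=\gamma({}^gs,{}^gx)$. A semi-real torsor datum for $G$ is a Galois datum $(S,k(i),N,\sigma,\gamma)$, $i^2=-1$, with a chosen splitting $S=N\oplus\mathrm{Gal}(k(i)|k)$, such that: $S$ is abelian; $k$ has a primitive root of unity of order the exponent of $N$; $\sigma$ has values in $\mu_2=\{\pm1\}$; $\gamma$ is a pairing (multiplicative in each argument) with values in $k^*$, $\gamma|_{\mathrm{Gal}(k(i)|k)\times N}=1$ and $\gamma(x,y)=\sigma(x,y)/\sigma(y,x)$ on $N\times N$; $N$ and $S$ are normal in $G$; $N$ is a 2-group; and for all $g\in G$, $[(\sigma,\gamma)]=[(\sigma^g,\gamma^g)]$ in $H^2_S(N,k(i)^*)$ and in $H^2_S(N,\mu_4)$. A real torsor datum for $G$ is a pair $(N,\sigma)$, where $N$ is a normal elementary abelian 2-subgroup of $G$ and $\sigma\in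 Z^2(N,\mu_2)$ is non-degenerate with $[\sigma]=[\sigma^g]$ in $H^2(N,\mu_2)$ for all $g\in G$; it is regarded as the Galois datum $(S,k,N,\sigma,\gamma)$ with $S=N$ and $\gamma=\gamma_\sigma$. Theorem. Let $A$ be a $G$-Galois algebra over $k$ with $|\mathrm{Aut}_G(A)|=|G|$. Then $A\simeq\mathrm{Ind}_S^G(A(k(i)_\sigma[N],\gamma))$ for a semi-real torsor datum $(S,k(i),N,\sigma,\gamma)$, or $A\simeq\mathrm{Ind}_S^G(A(k_\sigma[N],\gamma))$ for a real torsor datum $(N,\sigma)$, where $S=N$ and $\gamma=\gamma_\sigma$. In either case $N$ is an elementary abelian 2-group. -/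

import Mathlib

noncomputable section

/-! ### `G`-algebras, equivariant automorphisms, Galois algebras -/

/-- The group `Aut_G(A)` of `G`-equivariant `k`-algebra automorphisms of a `G`-algebra `A`. -/
def equivariantAut (k G A : Type*) [CommRing k] [Group G] [Ring A] [Algebra k A]
    [MulSemiringAction G A] : Subgroup (A ≃ₐ[k] A) where
  carrier := {f | ∀ (g : G) (a : A), f (g • a) = g • f a}
  one_mem' := fun _ _ => rfl
  mul_mem' := by
    intro f f' hf hf' g a
    change f (f' (g • a)) = g • f (f' a)
    rw [hf', hf]
  inv_mem' := by
    intro f hf g a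
    change f.symm (g • a) = g • f.symm a
    apply f.injective
    rw [hf, f.apply_symm_apply, f.apply_symm_apply]

/-- Two `G`-algebras over `k` are isomorphic: there is a `G`-equivariant isomorphism of
`k`-algebras between them. -/
def GAlgIsomorphic (k G A B : Type*) [CommRing k] [Group G] [Ring A] [Algebra k A]
    [MulSemiringAction G A] [Ring B] [Algebra k B] [MulSemiringAction G B] : Prop :=
  ∃ f : A ≃ₐ[k] B, ∀ (g : G) (a : A), f (g • a) = g • f a

/-- The canonical map `A ⊗ A → A ⊗ 𝒪(G)`, `x ⊗ y ↦ ∑ g, x (g • y) ⊗ δ_g`, where `A ⊗ 𝒪(G)` is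
identified with the functions `G → A` (for a finite group `G`). -/
def galoisCanMap (k G A : Type*) [CommRing k] [Group G] [Ring A] [Algebra k A]
    [MulSemiringAction G A] [SMulCommClass G k A] : TensorProduct k A A →ₗ[k] (G → A) :=
  TensorProduct.lift (LinearMap.mk₂ k (fun x y g => x * g • y)
    (by intro x x' y; funext g; simp [add_mul])
    (by intro c x y; funext g; simp)
    (by intro x y y'; funext g; simp [mul_add])
    (by intro c x y; funext g; simp [smul_comm g c y]))

/-- A `G`-algebra `A` over `k` is a `G`-Galois algebra, i.e. a Galois object for the Hopf algebra
`𝒪_k(G)` of functions on the finite group `G`. -/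
structure IsGaloisAlgebra (k G A : Type*) [CommRing k] [Group G] [Ring A] [Algebra k A]
    [MulSemiringAction G A] [SMulCommClass G k A] : Prop where
  faithfullyFlat : Module.FaithfullyFlat k A
  /-- the invariants are `k` -/
  invariants : ∀ a : A, (∀ g : G, g • a = a) ↔ a ∈ (algebraMap k A).range
  can_bijective : Function.Bijective (galoisCanMap k G A)

/-! ### Induced algebras -/

section Induced

variable (k : Type*) {G : Type*} [CommRing k] [Group G] (S : Subgroup G)
  (B : Type*) [Ring B] [Algebra k B] [MulSemiringAction S B] [SMulCommClass S k B]

/-- `Ind_S^G(B) = {r : G → B | r (s g) = s • r g}`. -/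
def inducedAlgebra : Subalgebra k (G → B) where
  carrier := {r | ∀ (s : S) (g : G), r (s * g) = s • r g}
  mul_mem' := by intro a b ha hb s g; simp [ha s g, hb s g, smul_mul']
  add_mem' := by intro a b ha hb s g; simp [ha s g, hb s g]
  algebraMap_mem' := by intro c s g; simp [Pi.algebraMap_apply, smul_algebraMap]

/-- The `G`-action `(g • r) x = r (x g)` on `Ind_S^G(B)`. -/
instance inducedAlgebra.instMulSemiringAction : MulSemiringAction G (inducedAlgebra k S B) where
  smul g r := ⟨fun x => r.1 (x * g), fun s x => by
    change r.1 (s * x * g) = s • r.1 (x * g)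
    rw [mul_assoc]; exact r.2 s (x * g)⟩
  one_smul r := Subtype.ext (funext fun x => congrArg r.1 (mul_one x))
  mul_smul g h r := Subtype.ext (funext fun x => congrArg r.1 (mul_assoc x g h).symm)
  smul_zero _ := rfl
  smul_add _ _ _ := rfl
  smul_one _ := rfl
  smul_mul _ _ _ := rfl

end Induced

/-! ### Two-cocycles and twisted group algebras -/

/-- Normalized 2-cocycles of `N` with values in the abelian group `M`, with trivial action. -/
structure TwoCocycle (N M : Type*) [Group N] [CommGroup M] where
  toFun : N → N → M
  one_left : ∀ x, toFun 1 x = 1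
  one_right : ∀ x, toFun x 1 = 1
  cocycle : ∀ x y z, toFun x y * toFun (x * y) z = toFun y z * toFun x (y * z)

namespace TwoCocycle

variable {N M : Type*} [Group N] [CommGroup M] (σ : TwoCocycle N M)

instance : CoeFun (TwoCocycle N M) (fun _ => N → N → M) := ⟨toFun⟩

/-- `s` is `σ`-regular if `σ(s,t) = σ(t,s)` for every `t` in the centralizer of `s`. -/
def IsRegular (s : N) : Prop := ∀ t : N, Commute s t → σ s t = σ t s

/-- `σ` is non-degenerate if `1` is the only `σ`-regular element. -/
def IsNondegenerate : Prop := ∀ s : N, σ.IsRegular s → s = 1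

/-- `γ_σ(x,y) = σ(x,y) σ(xy,x⁻¹) σ(x,x⁻¹)⁻¹`. -/
def inner (x y : N) : M := σ x y * σ (x * y) x⁻¹ * (σ x x⁻¹)⁻¹

/-- `Alt(σ)(x,y) = σ(x,y) / σ(y,x)`. -/
def alt (x y : N) : M := σ x y / σ y x

end TwoCocycle

/-- The twisted group algebra `K_σ[N]`: the `K`-vector space with basis `u_x`, `x ∈ N`, and
multiplication `(α u_x) (β u_y) = α β σ(x,y) u_{xy}`. -/
def TwistedGroupAlgebra {N K : Type*} [Group N] [Field K] (_σ : TwoCocycle N Kˣ) : Type _ := N →₀ K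

namespace TwistedGroupAlgebra

variable {N K : Type*} [Group N] [Field K] (σ : TwoCocycle N Kˣ)

instance : AddCommGroup (TwistedGroupAlgebra σ) := inferInstanceAs (AddCommGroup (N →₀ K))

/-- The element `α u_x`. -/
def single (x : N) : K →+ TwistedGroupAlgebra σ := Finsupp.singleAddHom x

theorem induction {σ : TwoCocycle N Kˣ} {p : TwistedGroupAlgebra σ → Prop}
    (a : TwistedGroupAlgebra σ) (zero : p 0) (add : ∀ a b, p a → p b → p (a + b))
    (single : ∀ x α, p (single σ x α)) : p a :=
  Finsupp.induction_linear (motive := p) a zero add single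

instance : Mul (TwistedGroupAlgebra σ) :=
  ⟨fun a b => Finsupp.sum (M := K) a fun x α => Finsupp.sum (M := K) b fun y β =>
    single σ (x * y) (α * β * σ x y)⟩

instance : One (TwistedGroupAlgebra σ) := ⟨single σ 1 1⟩

theorem mul_def (a b : TwistedGroupAlgebra σ) :
    a * b = Finsupp.sum (M := K) a fun x α => Finsupp.sum (M := K) b fun y β =>
      single σ (x * y) (α * β * σ x y) := rfl

theorem one_def : (1 : TwistedGroupAlgebra σ) = single σ 1 1 := rfl

theorem single_mul_single (x y : N) (α β : K) :
    single σ x α * single σ y β = single σ (x * y) (α * β * σ x y) :=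
  (Finsupp.sum_single_index (by simp [Finsupp.sum])).trans (Finsupp.sum_single_index (by simp))

theorem add_mul_aux (a b c : TwistedGroupAlgebra σ) : (a + b) * c = a * c + b * c :=
  Finsupp.sum_add_index' (by simp [Finsupp.sum])
    (by intro x α α'; simp [Finsupp.sum, add_mul, Finset.sum_add_distrib])

theorem mul_add_aux (a b c : TwistedGroupAlgebra σ) : a * (b + c) = a * b + a * c := by
  simp only [mul_def]
  refine Eq.trans ?_ Finsupp.sum_add
  refine congrArg (Finsupp.sum (M := K) a) (funext fun x => funext fun α => ?_)
  exact Finsupp.sum_add_index' (by simp) (by intro y β β'; simp [mul_add, add_mul])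

theorem zero_mul_aux (a : TwistedGroupAlgebra σ) : 0 * a = 0 := Finsupp.sum_zero_index

theorem mul_zero_aux (a : TwistedGroupAlgebra σ) : a * 0 = 0 := by
  have h := mul_add_aux σ a 0 0
  rw [add_zero] at h
  exact left_eq_add.mp h

instance : Ring (TwistedGroupAlgebra σ) :=
  { (inferInstance : AddCommGroup (TwistedGroupAlgebra σ)) with
    left_distrib := mul_add_aux σ
    right_distrib := add_mul_aux σ
    zero_mul := zero_mul_aux σ
    mul_zero := mul_zero_aux σ
    one_mul := fun a => by
      induction a using induction with
      | zero => exact mul_zero_aux σ 1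
      | add a b ha hb => rw [mul_add_aux, ha, hb]
      | single x α => simp [one_def, single_mul_single, σ.one_left]
    mul_one := fun a => by
      induction a using induction with
      | zero => exact zero_mul_aux σ 1
      | add a b ha hb => rw [add_mul_aux, ha, hb]
      | single x α => simp [one_def, single_mul_single, σ.one_right]
    mul_assoc := fun a b c => by
      induction a using induction with
      | zero => simp only [zero_mul_aux]
      | add a a' ha ha' => simp only [add_mul_aux, ha, ha']
      | single x α =>
        induction b using induction with
        | zero => simp only [zero_mul_aux, mul_zero_aux]
        | add b b' hb hb' => simp only [add_mul_aux, mul_add_aux, hb, hb']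
        | single y β =>
          induction c using induction with
          | zero => simp only [mul_zero_aux]
          | add c c' hc hc' => simp only [mul_add_aux, hc, hc']
          | single z δ =>
            have h : (σ x y : K) * σ (x * y) z = σ y z * σ x (y * z) := by
              exact_mod_cast congrArg Units.val (σ.cocycle x y z)
            simp only [single_mul_single, mul_assoc x y z]
            congr 1
            linear_combination (α * β * δ) * h }

instance (R : Type*) [CommRing R] [Algebra R K] : Module R (TwistedGroupAlgebra σ) :=
  inferInstanceAs (Module R (N →₀ K))

theorem smul_single {R : Type*} [CommRing R] [Algebra R K] (r : R) (x : N) (α : K) :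
    r • single σ x α = single σ x (r • α) :=
  Finsupp.smul_single r x α

/-- `K_σ[N]` is an algebra over every ring `R` over which `K` is an algebra. -/
instance (R : Type*) [CommRing R] [Algebra R K] : Algebra R (TwistedGroupAlgebra σ) :=
  Algebra.ofModule
    (fun r a b => by
      induction a using induction with
      | zero => simp
      | add a a' ha ha' => simp only [smul_add, add_mul, ha, ha']
      | single x α =>
        induction b using induction with
        | zero => simp
        | add b b' hb hb' => simp only [smul_add, mul_add, hb, hb']
        | single y β => simp [smul_single, single_mul_single])
    (fun r a b => by
      induction a using induction with
      | zero => simp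
      | add a a' ha ha' => simp only [smul_add, add_mul, ha, ha']
      | single x α =>
        induction b using induction with
        | zero => simp
        | add b b' hb hb' => simp only [smul_add, mul_add, hb, hb']
        | single y β => simp [smul_single, single_mul_single])

end TwistedGroupAlgebra

/-! ### Galois data -/

/-- The conjugate `ᵍx = g x g⁻¹` as an element of a subgroup `N` stable under conjugation
by `g`. -/
def conjIn {G : Type*} [Group G] (N : Subgroup G) (g : G) (hg : ∀ x ∈ N, g * x * g⁻¹ ∈ N)
    (x : N) : N := ⟨g * x * g⁻¹, hg x x.2⟩

/-- A Galois datum `(S, K, N, σ, γ)` associated to `G`, over the field `k`. The field `toGal`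
with its two properties is the identification of `S/N` with `Gal(K|k)`; the pair `(σ, γ)` is a
2-cocycle in `Z²_S(N, Kˣ)` such that `γ = γ_σ` on `N × N`. -/
structure GaloisDatum (k K G : Type*) [Field k] [Field K] [Algebra k K] [Group G] where
  S : Subgroup G
  N : Subgroup G
  N_le : N ≤ S
  conj_mem : ∀ g ∈ S, ∀ x ∈ N, g * x * g⁻¹ ∈ N
  isGalois : IsGalois k K
  toGal : S →* (K ≃ₐ[k] K)
  toGal_surjective : Function.Surjective toGal
  toGal_ker : toGal.ker = N.subgroupOf S
  not_char_dvd : ¬ ringChar k ∣ Nat.card N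
  σ : TwoCocycle N Kˣ
  nondegenerate : σ.IsNondegenerate
  γ : S → N → Kˣ
  γ_one_left : ∀ x, γ 1 x = 1
  γ_one_right : ∀ g, γ g 1 = 1
  γ_mul_right : ∀ (g : S) (x y : N), toGal g (σ x y : K) * γ g (x * y) =
    σ (conjIn N g (conj_mem g g.2) x) (conjIn N g (conj_mem g g.2) y) * γ g x * γ g y
  γ_mul_left : ∀ (g h : S) (x : N), (γ (g * h) x : K) =
    toGal g (γ h x : K) * γ g (conjIn N h (conj_mem h h.2) x)
  γ_eq_inner : ∀ x y : N, γ (Subgroup.inclusion N_le x) y = σ.inner x y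

namespace GaloisDatum

variable {k K G : Type*} [Field k] [Field K] [Algebra k K] [Group G] (D : GaloisDatum k K G)

/-- The conjugation action of `S` on `N`. -/
def conjS (g : D.S) (x : D.N) : D.N := conjIn D.N g (D.conj_mem g g.2) x

/-- The pair `(σ', γ')` and the pair `(σ, γ)` of the datum have the same class with coefficients
in the subgroup `U` of `Kˣ`: they differ by the coboundary of a normalized 1-cochain `η : N → U`.
For `U = Kˣ` this is equality in `H²_S(N, Kˣ)`, for `U = μ₄` (and pairs with values in `μ₄`)
equality in `H²_S(N, μ₄)`. -/
def CohomologousIn (U : Subgroup Kˣ) (σ' : D.N → D.N → Kˣ) (γ' : D.S → D.N → Kˣ) : Prop :=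
  ∃ η : D.N → Kˣ, (∀ x, η x ∈ U) ∧ η 1 = 1 ∧
    (∀ x y, σ' x y = D.σ x y * (η y * η x / η (x * y))) ∧
    (∀ g x, (γ' g x : K) = D.γ g x * (D.toGal g (η x : K) / η (D.conjS g x)))

/-- The algebra `A(K_σ[N], γ)`: the twisted group algebra `K_σ[N]`, with the `S`-action given
below. -/
def Alg : Type _ := TwistedGroupAlgebra D.σ

instance : Ring D.Alg := inferInstanceAs (Ring (TwistedGroupAlgebra D.σ))

instance : Algebra k D.Alg := inferInstanceAs (Algebra k (TwistedGroupAlgebra D.σ))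

/-- The element `α u_x`. -/
def single (x : D.N) : K →+ D.Alg := TwistedGroupAlgebra.single D.σ x

theorem Alg.induction {D : GaloisDatum k K G} {p : D.Alg → Prop}
    (a : D.Alg) (zero : p 0) (add : ∀ a b, p a → p b → p (a + b))
    (single : ∀ x α, p (D.single x α)) : p a :=
  TwistedGroupAlgebra.induction a zero add single

/-- `g • (α u_x) = ḡ(α) γ(g,x) u_{ᵍx}`. -/
def act (g : D.S) : D.Alg →+ D.Alg :=
  Finsupp.liftAddHom (M := K) fun x =>
    (D.single (D.conjS g x)).comp
      ((AddMonoidHom.mulRight (D.γ g x : K)).comp (D.toGal g : K →+* K).toAddMonoidHom)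

theorem act_single (g : D.S) (x : D.N) (α : K) :
    D.act g (D.single x α) = D.single (D.conjS g x) (D.toGal g α * D.γ g x) :=
  Finsupp.liftAddHom_apply_single (M := K) _ x α

theorem single_mul_single (x y : D.N) (α β : K) :
    D.single x α * D.single y β = D.single (x * y) (α * β * D.σ x y) :=
  TwistedGroupAlgebra.single_mul_single D.σ x y α β

theorem smul_single (r : k) (x : D.N) (α : K) : r • D.single x α = D.single x (r • α) :=
  TwistedGroupAlgebra.smul_single D.σ r x α

theorem conjS_one_right (g : D.S) : D.conjS g 1 = 1 := Subtype.ext (by simp [conjS, conjIn])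

theorem conjS_mul_right (g : D.S) (x y : D.N) :
    D.conjS g (x * y) = D.conjS g x * D.conjS g y :=
  Subtype.ext (by simp [conjS, conjIn])

theorem conjS_one_left (x : D.N) : D.conjS 1 x = x := Subtype.ext (by simp [conjS, conjIn])

theorem conjS_mul_left (g h : D.S) (x : D.N) : D.conjS (g * h) x = D.conjS g (D.conjS h x) :=
  Subtype.ext (by simp [conjS, conjIn, mul_assoc])

instance : MulSemiringAction D.S D.Alg where
  smul g a := D.act g a
  one_smul a := by
    change D.act 1 a = a
    induction a using Alg.induction with
    | zero => simp
    | add a b ha hb => rw [map_add, ha, hb]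
    | single x α => simp [act_single, conjS_one_left, D.γ_one_left]
  mul_smul g h a := by
    change D.act (g * h) a = D.act g (D.act h a)
    induction a using Alg.induction with
    | zero => simp
    | add a b ha hb => simp only [map_add, ha, hb]
    | single x α =>
      simp only [act_single, conjS_mul_left, map_mul, AlgEquiv.mul_apply]
      rw [D.γ_mul_left, mul_assoc]
      rfl
  smul_zero g := map_zero (D.act g)
  smul_add g a b := map_add (D.act g) a b
  smul_one g := by
    change D.act g (D.single 1 1) = D.single 1 1
    simp [act_single, conjS_one_right, D.γ_one_right]
  smul_mul g a b := by
    change D.act g (a * b) = D.act g a * D.act g b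
    induction a using Alg.induction with
    | zero => simp
    | add a a' ha ha' => simp only [map_add, add_mul, ha, ha']
    | single x α =>
      induction b using Alg.induction with
      | zero => simp
      | add b b' hb hb' => simp only [map_add, mul_add, hb, hb']
      | single y β =>
        simp only [act_single, single_mul_single, conjS_mul_right, map_mul]
        congr 1
        have h := D.γ_mul_right g x y
        change D.toGal g (D.σ x y : K) * D.γ g (x * y) =
          D.σ (D.conjS g x) (D.conjS g y) * D.γ g x * D.γ g y at h
        linear_combination (D.toGal g α * D.toGal g β) * h

instance : SMulCommClass D.S k D.Alg where
  smul_comm g r a := by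
    change D.act g (r • a) = r • D.act g a
    induction a using Alg.induction with
    | zero => simp
    | add a b ha hb => simp only [smul_add, map_add, ha, hb]
    | single x α => simp [act_single, smul_single]

/-- The induced `G`-algebra `Ind_S^G(A(K_σ[N], γ))`. -/
abbrev Ind : Subalgebra k (G → D.Alg) := inducedAlgebra k D.S D.Alg

end GaloisDatum

/-! ### Torsor data -/

/-- A torsor datum: a Galois datum `(S, K, N, σ, γ)` with a splitting `S = N ⊕ Gal(K|k)` and the
properties below. -/
structure TorsorDatum (k K G : Type*) [Field k] [Field K] [Algebra k K] [Group G]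
    extends GaloisDatum k K G where
  S_comm : ∀ s ∈ S, ∀ t ∈ S, s * t = t * s
  /-- the splitting -/
  sec : (K ≃ₐ[k] K) →* S
  toGal_sec : ∀ ω, toGal (sec ω) = ω
  exists_primitiveRoot : ∃ ζ : k, IsPrimitiveRoot ζ (Monoid.exponent N)
  σ_mem : ∀ x y, σ x y ∈ (Units.map (algebraMap k K : k →* K)).range
  γ_mem : ∀ s x, γ s x ∈ (Units.map (algebraMap k K : k →* K)).range
  γ_pairing_left : ∀ s t x, γ (s * t) x = γ s x * γ t x
  γ_pairing_right : ∀ s x y, γ s (x * y) = γ s x * γ s y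
  γ_sec : ∀ ω x, γ (sec ω) x = 1
  γ_alt : ∀ x y : N, γ (Subgroup.inclusion N_le x) y = σ.alt x y
  N_normal : N.Normal
  S_normal : S.Normal
  /-- `[(σ, γ)] = [(σᵍ, γᵍ)]` in `H²_S(N, Kˣ)` -/
  cohomologous : ∀ g : G, toGaloisDatum.CohomologousIn ⊤
    (fun x y => σ (conjIn N g (fun n hn => N_normal.conj_mem n hn g) x)
      (conjIn N g (fun n hn => N_normal.conj_mem n hn g) y))
    (fun s x => γ (conjIn S g (fun n hn => S_normal.conj_mem n hn g) s)
      (conjIn N g (fun n hn => N_normal.conj_mem n hn g) x))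

/-- The field `k(i)`, `i² = -1`. -/
abbrev AdjoinI (k : Type*) [Field k] : Type _ :=
  (Polynomial.X ^ 2 + 1 : Polynomial k).SplittingField

/-- A semi-real torsor datum for `G`: a torsor datum `(S, k(i), N, σ, γ)` such that `N` is an
(abelian) 2-group, `σ` has values in `μ₂ = ⟨-1⟩`, and `[(σ, γ)] = [(σᵍ, γᵍ)]` in `H²_S(N, μ₄)`. -/
structure SemiRealTorsorDatum (k G : Type*) [Field k] [Group G]
    extends TorsorDatum k (AdjoinI k) G where
  isPGroup : IsPGroup 2 N
  σ_mem_two : ∀ x y, σ x y ∈ Subgroup.zpowers (-1 : (AdjoinI k)ˣ)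
  cohomologous_four : ∀ g : G, toGaloisDatum.CohomologousIn (rootsOfUnity 4 (AdjoinI k))
    (fun x y => σ (conjIn N g (fun n hn => N_normal.conj_mem n hn g) x)
      (conjIn N g (fun n hn => N_normal.conj_mem n hn g) y))
    (fun s x => γ (conjIn S g (fun n hn => S_normal.conj_mem n hn g) s)
      (conjIn N g (fun n hn => N_normal.conj_mem n hn g) x))

/-- `N` is an elementary abelian 2-group. -/
structure IsElementaryAbelianTwo {G : Type*} [Group G] (N : Subgroup G) : Prop where
  comm : ∀ x ∈ N, ∀ y ∈ N, x * y = y * x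
  sq_eq_one : ∀ x ∈ N, x ^ 2 = 1

/-- A real torsor datum `(N, σ)` for `G`: `N` is a normal elementary abelian 2-subgroup,
`σ ∈ Z²(N, μ₂)` is non-degenerate and `[σ] = [σᵍ]` in `H²(N, μ₂)` for all `g`, where
`μ₂ = ⟨-1⟩ ⊆ kˣ`. -/
structure RealTorsorDatum (k G : Type*) [Field k] [Group G] where
  N : Subgroup G
  N_normal : N.Normal
  elementary : IsElementaryAbelianTwo N
  σ : TwoCocycle N kˣ
  σ_mem_two : ∀ x y, σ x y ∈ Subgroup.zpowers (-1 : kˣ)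
  nondegenerate : σ.IsNondegenerate
  cohomologous : ∀ g : G, ∃ η : N → kˣ,
    (∀ x, η x ∈ Subgroup.zpowers (-1 : kˣ)) ∧ η 1 = 1 ∧
    ∀ x y, σ (conjIn N g (fun n hn => N_normal.conj_mem n hn g) x)
      (conjIn N g (fun n hn => N_normal.conj_mem n hn g) y) =
        σ x y * (η y * η x / η (x * y))

namespace TwoCocycle

variable {N M : Type*} [Group N] [CommGroup M] (σ : TwoCocycle N M)

theorem inner_eq_alt (hN : ∀ x y : N, x * y = y * x) (x y : N) : σ.inner x y = σ.alt x y := by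
  have h := σ.cocycle y x x⁻¹
  rw [mul_inv_cancel, σ.one_right, mul_one] at h
  rw [inner, alt, hN x y, ← h, mul_inv, div_eq_mul_inv]
  rw [mul_assoc, mul_comm (σ y x)⁻¹, mul_inv_cancel_left]

theorem alt_mul_left (hN : ∀ x y : N, x * y = y * x) (x y z : N) :
    σ.alt (x * y) z = σ.alt x z * σ.alt y z := by
  have h1 := σ.cocycle x y z
  have h2 := σ.cocycle x z y
  have h3 := σ.cocycle z x y
  rw [hN z y] at h2
  rw [hN z x] at h3
  have e1 : σ (x * y) z = σ y z * σ x (y * z) / σ x y := by rw [← h1]; simp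
  have e2 : σ z (x * y) = σ z x * σ (x * z) y / σ x y := by rw [h3]; simp
  have e3 : σ (x * z) y = σ z y * σ x (y * z) / σ x z := by rw [← h2]; simp
  simp only [alt, e1, e2, e3, div_eq_mul_inv, mul_inv, inv_inv]
  apply Additive.ofMul.injective
  simp only [ofMul_mul, ofMul_inv]
  abel

theorem alt_symm (x y : N) : σ.alt x y = (σ.alt y x)⁻¹ := by simp [alt]

theorem alt_mul_right (hN : ∀ x y : N, x * y = y * x) (x y z : N) :
    σ.alt x (y * z) = σ.alt x y * σ.alt x z := by
  rw [alt_symm, alt_mul_left σ hN, mul_inv, ← alt_symm, ← alt_symm]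

end TwoCocycle

/-- A real torsor datum `(N, σ)` over a formally real field, regarded as the Galois datum
`(N, k, N, σ, γ_σ)`. -/
def RealTorsorDatum.toGaloisDatum {k G : Type*} [Field k] [IsSemireal k] [Group G] [Finite G]
    (D : RealTorsorDatum k G) : GaloisDatum k k G :=
  have hc : ∀ x y : D.N, x * y = y * x := fun x y =>
    Subtype.ext (D.elementary.comm x x.2 y y.2)
  have hconj : ∀ (g x : D.N) (h : ∀ n ∈ D.N, (g : G) * n * (g : G)⁻¹ ∈ D.N),
      conjIn D.N g h x = x := fun g x _ => by
    apply Subtype.ext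
    change (g : G) * x * (g : G)⁻¹ = x
    rw [D.elementary.comm g g.2 x x.2, mul_inv_cancel_right]
  { S := D.N
    N := D.N
    N_le := le_rfl
    conj_mem := fun g hg x hx => D.N.mul_mem (D.N.mul_mem hg hx) (D.N.inv_mem hg)
    isGalois := inferInstance
    toGal := 1
    toGal_surjective := fun _ => ⟨1, Subsingleton.elim _ _⟩
    toGal_ker := by simp
    not_char_dvd := by
      rw [ringChar.eq_zero, zero_dvd_iff]
      exact Nat.card_pos.ne'
    σ := D.σ
    nondegenerate := D.nondegenerate
    γ := D.σ.inner
    γ_one_left := fun x => by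
      simp [D.σ.inner_eq_alt hc, TwoCocycle.alt, D.σ.one_left, D.σ.one_right]
    γ_one_right := fun x => by
      simp [D.σ.inner_eq_alt hc, TwoCocycle.alt, D.σ.one_left, D.σ.one_right]
    γ_mul_right := fun g x y => by
      simp only [hconj, D.σ.inner_eq_alt hc, D.σ.alt_mul_right hc]
      simp [mul_assoc]
    γ_mul_left := fun g h x => by
      simp only [hconj, D.σ.inner_eq_alt hc, D.σ.alt_mul_left hc]
      simp [mul_comm]
    γ_eq_inner := fun _ _ => rfl }

end

/-!
A maximal two-sided ideal `M` of `A` has only finitely many conjugates, they intersect in `0`, and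
so `A` is induced from the Galois algebra `B = A ⧸ M` of the stabilizer `S` of `M`. Let `K` be the
center of `B`, so that `K` is `k` or `k(i)`. By Skolem–Noether, each element `x` of the kernel `N`
of `S → Gal(K|k)` acts on `B` as conjugation by an element `u x`; these elements form a `K`-basis of
`B`, and they multiply by a 2-cocycle `σ` while `S` permutes them up to scalars `γ`.

An `S`-equivariant automorphism of `B` trivial on `K` rescales each `u x`, and hence is an
equivariant character of `N`. Counting characters gives `|Aut_S(B)| ≤ |S|`. On the other hand,
`|Aut_G(A)| = |G|` and the orbits of `M` under both groups force `|Aut_S(B)| ≥ |S|`. So there are as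
many automorphisms as possible: `N` has `|N|` equivariant characters, which leaves only characters
of order 2 over a real closed field, `S` is normal in `G`, and every conjugation by `G` extends to
`B`, which makes the class of `(σ, γ)` invariant. Since positive elements of `k` have square roots,
the `u x` can be normalized by `u x ^ 4 = 1`, and then all the cochains involved take values in
roots of unity.
-/

noncomputable section

/-! ### Real closed fields -/

section Semireal

variable {k : Type*} [Field k] [IsSemireal k]

theorem sq_ne_neg_one (x : k) : x ^ 2 ≠ -1 := fun h =>
  IsSemireal.one_add_ne_zero (IsSumSq.mul_self x) (by rw [← sq, h, add_neg_cancel])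

theorem eq_one_of_isSumSq_of_pow_eq_one {x : k} (hx : IsSumSq x) {n : ℕ} (hn : n ≠ 0)
    (h : x ^ n = 1) : x = 1 := by
  obtain ⟨m, rfl⟩ := Nat.exists_eq_succ_of_ne_zero hn
  have hprod : (∑ i ∈ Finset.range (m + 1), x ^ i) * (x - 1) = 0 := by
    rw [geom_sum_mul, h, sub_self]
  refine sub_eq_zero.mp ((mul_eq_zero.mp hprod).resolve_left fun hsum => ?_)
  rw [Finset.sum_range_succ', pow_zero, add_comm] at hsum
  have hpow (i : ℕ) : IsSumSq (x ^ i) := by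
    simpa using pow_mem (Subsemiring.mem_sumSq.mpr hx) i
  exact IsSemireal.one_add_ne_zero (IsSumSq.sum fun i _ => hpow (i + 1)) hsum

theorem sq_eq_one_of_pow_eq_one {x : k} {n : ℕ} (hn : n ≠ 0) (h : x ^ n = 1) : x ^ 2 = 1 :=
  eq_one_of_isSumSq_of_pow_eq_one (sq x ▸ IsSumSq.mul_self x) hn
    (by rw [pow_right_comm, h, one_pow])

theorem eq_zero_of_sq_add_eq_zero {x s : k} (hs : IsSumSq s) (h : x ^ 2 + s = 0) : x = 0 := by
  by_contra hx
  refine IsSemireal.one_add_ne_zero (hs.mul (IsSumSq.mul_self x⁻¹)) ?_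
  rw [← mul_right_inj' (pow_ne_zero 2 hx)]
  field_simp
  simpa using h

end Semireal

section PowerOfTwo

theorem exists_subgroup_index_eq_two {P : Type*} [Group P] [Finite P] {n : ℕ}
    (hP : Nat.card P = 2 ^ (n + 1)) : ∃ H : Subgroup P, H.index = 2 := by
  have : Fact (Nat.Prime 2) := ⟨Nat.prime_two⟩
  obtain ⟨H, hH⟩ := Sylow.exists_subgroup_card_pow_prime (G := P) 2
    (hP ▸ pow_dvd_pow 2 (Nat.le_succ n))
  refine ⟨H, Nat.eq_of_mul_eq_mul_left (Nat.pos_of_ne_zero (pow_ne_zero n two_ne_zero)) ?_⟩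
  rw [← hH, H.card_mul_index, hP, hH, pow_succ]

variable {F E : Type*} [Field F] [Field E] [Algebra F E]

theorem finrank_ne_two_of_forall_isSquare [CharZero F] (hF : ∀ a : F, IsSquare a) :
    Module.finrank F E ≠ 2 := by
  intro h
  have : Algebra.IsQuadraticExtension F E := ⟨h⟩
  have hroot : (primitiveRoots (Module.finrank F E) F).Nonempty :=
    ⟨-1, (mem_primitiveRoots (by omega)).mpr (h ▸ IsPrimitiveRoot.neg_one 0 (by decide))⟩
  have hcyclic : IsGalois F E ∧ IsCyclic (E ≃ₐ[F] E) := ⟨inferInstance, inferInstance⟩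
  obtain ⟨a, ha, -⟩ := ((isCyclic_tfae F E hroot).out 0 1).mp hcyclic
  obtain ⟨b, hb⟩ := hF a
  rw [h] at ha
  exact pow_ne_of_irreducible_X_pow_sub_C ha dvd_rfl (by decide) b (by rw [hb, sq])

theorem finrank_eq_one_of_finrank_eq_two_pow [CharZero F] [FiniteDimensional F E] [IsGalois F E]
    (hF : ∀ a : F, IsSquare a) {n : ℕ} (h : Module.finrank F E = 2 ^ n) :
    Module.finrank F E = 1 := by
  cases n with
  | zero => simpa using h
  | succ n =>
    obtain ⟨H, hH⟩ := exists_subgroup_index_eq_two ((IsGalois.card_aut_eq_finrank F E).trans h)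
    refine absurd ?_ (finrank_ne_two_of_forall_isSquare (E := IntermediateField.fixedField H) hF)
    rw [IntermediateField.finrank_eq_fixingSubgroup_index,
      IntermediateField.fixingSubgroup_fixedField, hH]

end PowerOfTwo

section RealClosed

variable {k : Type*} [Field k] [IsRealClosed k]

theorem isSquare_sq_add_sq (a b : k) : IsSquare (a ^ 2 + b ^ 2) := by
  rcases IsRealClosed.isSquare_or_isSquare_neg (a ^ 2 + b ^ 2) with h | ⟨c, hc⟩
  · exact h
  · have ha : a = 0 := eq_zero_of_sq_add_eq_zero (s := b * b + c * c)
      ((IsSumSq.mul_self b).add (IsSumSq.mul_self c)) (by linear_combination -hc)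
    exact ⟨b, by rw [ha]; ring⟩

variable {E : Type*} [Field E] [Algebra k E] [FiniteDimensional k E]

theorem finrank_eq_one_of_odd (h : Odd (Module.finrank k E)) : Module.finrank k E = 1 := by
  obtain ⟨θ, hθ⟩ := Field.exists_primitive_element k E
  have hint : IsIntegral k θ := IsIntegral.of_finite k θ
  have hdeg : (minpoly k θ).natDegree = Module.finrank k E := by
    rw [← IntermediateField.adjoin.finrank hint, hθ, IntermediateField.finrank_top']
  obtain ⟨x, hx⟩ := IsRealClosed.exists_isRoot_of_odd_natDegree (f := minpoly k θ) (hdeg ▸ h)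
  rw [← hdeg]
  exact Polynomial.natDegree_eq_of_degree_eq_some
    (Polynomial.degree_eq_one_of_irreducible_of_root (minpoly.irreducible hint) hx)

variable (k E) in
theorem exists_finrank_eq_two_pow [IsGalois k E] : ∃ n, Module.finrank k E = 2 ^ n := by
  have : Fact (Nat.Prime 2) := ⟨Nat.prime_two⟩
  let P : Sylow 2 (E ≃ₐ[k] E) := default
  have hodd : Odd (P : Subgroup (E ≃ₐ[k] E)).index :=
    Nat.odd_iff.mpr (Nat.two_dvd_ne_zero.mp P.not_dvd_index)
  have hfixed : Module.finrank k (IntermediateField.fixedField (P : Subgroup (E ≃ₐ[k] E))) =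
      (P : Subgroup (E ≃ₐ[k] E)).index := by
    rw [IntermediateField.finrank_eq_fixingSubgroup_index,
      IntermediateField.fixingSubgroup_fixedField]
  have htop : (P : Subgroup (E ≃ₐ[k] E)) = ⊤ := by
    rw [← Subgroup.index_eq_one, ← hfixed, finrank_eq_one_of_odd (hfixed ▸ hodd)]
  obtain ⟨n, hn⟩ := IsPGroup.iff_card.mp P.isPGroup'
  exact ⟨n, by rw [← hn, htop, Subgroup.card_top, IsGalois.card_aut_eq_finrank]⟩

end RealClosed

/-! ### The field `k(i)` -/

namespace AdjoinI

variable {k : Type*} [Field k]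

variable (k) in
theorem exists_sq_eq_neg_one : ∃ i : AdjoinI k, i ^ 2 = -1 := by
  have hdeg : (Polynomial.X ^ 2 + 1 : Polynomial k).degree = 2 := by compute_degree!
  obtain ⟨i, hi⟩ := (Polynomial.SplittingField.splits
    (Polynomial.X ^ 2 + 1 : Polynomial k)).exists_eval_eq_zero (by
      rw [Polynomial.degree_map, hdeg]; decide)
  exact ⟨i, by simpa [add_eq_zero_iff_eq_neg] using hi⟩

theorem exists_eq_add_mul {i : AdjoinI k} (hi : i ^ 2 = -1) (z : AdjoinI k) :
    ∃ a b : k, z = algebraMap k _ a + algebraMap k _ b * i := by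
  have hz : z ∈ Algebra.adjoin k
      ((Polynomial.X ^ 2 + 1 : Polynomial k).rootSet (AdjoinI k)) := by
    rw [Polynomial.SplittingField.adjoin_rootSet]
    trivial
  induction hz using Algebra.adjoin_induction with
  | mem x hx =>
    have hx2 : x ^ 2 = i ^ 2 := by
      simpa [hi, add_eq_zero_iff_eq_neg] using (Polynomial.mem_rootSet'.mp hx).2
    rcases sq_eq_sq_iff_eq_or_eq_neg.mp hx2 with rfl | rfl
    · exact ⟨0, 1, by simp⟩
    · exact ⟨0, -1, by simp⟩
  | algebraMap r => exact ⟨r, 0, by simp⟩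
  | add x y _ _ hx hy =>
    obtain ⟨a, b, rfl⟩ := hx
    obtain ⟨c, d, rfl⟩ := hy
    exact ⟨a + c, b + d, by simp only [map_add]; ring⟩
  | mul x y _ _ hx hy =>
    obtain ⟨a, b, rfl⟩ := hx
    obtain ⟨c, d, rfl⟩ := hy
    refine ⟨a * c - b * d, a * d + b * c, ?_⟩
    simp only [map_sub, map_add, map_mul]
    linear_combination (algebraMap k (AdjoinI k) b * algebraMap k (AdjoinI k) d) * hi

instance [CharZero k] : IsGalois k (AdjoinI k) where
  to_isSeparable := inferInstance
  to_normal := inferInstance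

section Semireal

variable [IsSemireal k]

theorem algebraMap_ne {i : AdjoinI k} (hi : i ^ 2 = -1) (x : k) :
    algebraMap k (AdjoinI k) x ≠ i := by
  rintro rfl
  exact sq_ne_neg_one x ((algebraMap k (AdjoinI k)).injective (by simpa using hi))

theorem apply_eq_neg_of_ne_one {i : AdjoinI k} (hi : i ^ 2 = -1)
    {ω : AdjoinI k ≃ₐ[k] AdjoinI k} (hω : ω ≠ 1) : ω i = -i := by
  have hsq : (ω i) ^ 2 = i ^ 2 := by rw [← map_pow, hi, map_neg, map_one]
  refine (sq_eq_sq_iff_eq_or_eq_neg.mp hsq).resolve_left fun hfix => hω ?_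
  ext z
  obtain ⟨a, b, rfl⟩ := exists_eq_add_mul hi z
  simp [hfix]

theorem eq_of_ne_one {ω ω' : AdjoinI k ≃ₐ[k] AdjoinI k} (hω : ω ≠ 1) (hω' : ω' ≠ 1) :
    ω = ω' := by
  obtain ⟨i, hi⟩ := exists_sq_eq_neg_one k
  ext z
  obtain ⟨a, b, rfl⟩ := exists_eq_add_mul hi z
  simp [apply_eq_neg_of_ne_one hi hω, apply_eq_neg_of_ne_one hi hω']

theorem aut_mul_self (ω : AdjoinI k ≃ₐ[k] AdjoinI k) : ω * ω = 1 := by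
  by_contra h
  have hω : ω ≠ 1 := fun hω => h (by rw [hω, mul_one])
  exact hω (mul_eq_left.mp (eq_of_ne_one h hω))

variable (k) in
theorem exists_aut_ne_one : ∃ ω : AdjoinI k ≃ₐ[k] AdjoinI k, ω ≠ 1 := by
  obtain ⟨i, hi⟩ := exists_sq_eq_neg_one k
  by_contra! h
  obtain ⟨x, hx⟩ := (IsGalois.mem_range_algebraMap_iff_fixed (F := k) i).mpr
    fun ω => by rw [h ω]; rfl
  exact algebraMap_ne hi x hx

theorem card_aut : Nat.card (AdjoinI k ≃ₐ[k] AdjoinI k) = 2 := by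
  obtain ⟨ω, hω⟩ := exists_aut_ne_one k
  refine Nat.card_eq_two_iff.mpr ⟨1, ω, hω.symm, Set.eq_univ_of_forall fun ω' => ?_⟩
  by_cases h : ω' = 1
  · exact .inl h
  · exact .inr (eq_of_ne_one h hω)

theorem finrank_eq_two : Module.finrank k (AdjoinI k) = 2 := by
  rw [← IsGalois.card_aut_eq_finrank, card_aut]

theorem exists_isSumSq_apply_mul {ω : AdjoinI k ≃ₐ[k] AdjoinI k} (hω : ω ≠ 1) (z : AdjoinI k) :
    ∃ s : k, IsSumSq s ∧ ω z * z = algebraMap k (AdjoinI k) s := by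
  obtain ⟨i, hi⟩ := exists_sq_eq_neg_one k
  obtain ⟨a, b, rfl⟩ := exists_eq_add_mul hi z
  refine ⟨a * a + b * b, (IsSumSq.mul_self a).add (IsSumSq.mul_self b), ?_⟩
  simp only [map_add, map_mul, AlgEquiv.commutes, apply_eq_neg_of_ne_one hi hω]
  linear_combination - (algebraMap k (AdjoinI k) b) ^ 2 * hi

theorem apply_mul_eq_one_of_pow_eq_one {ω : AdjoinI k ≃ₐ[k] AdjoinI k} (hω : ω ≠ 1)
    {z : AdjoinI k} {n : ℕ} (hn : n ≠ 0) (hz : (ω z * z) ^ n = 1) : ω z * z = 1 := by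
  obtain ⟨s, hs, h⟩ := exists_isSumSq_apply_mul hω z
  rw [h] at hz ⊢
  rw [eq_one_of_isSumSq_of_pow_eq_one hs hn
    ((algebraMap k (AdjoinI k)).injective (by simpa using hz)), map_one]

theorem exists_eq_algebraMap_of_apply_eq {ω : AdjoinI k ≃ₐ[k] AdjoinI k} (hω : ω ≠ 1)
    {z : AdjoinI k} (hz : ω z = z) : ∃ a : k, z = algebraMap k (AdjoinI k) a := by
  obtain ⟨a, ha⟩ := (IsGalois.mem_range_algebraMap_iff_fixed (F := k) z).mpr fun ω' => by
    by_cases h : ω' = 1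
    · rw [h]; rfl
    · rw [eq_of_ne_one h hω, hz]
  exact ⟨a, ha.symm⟩

/-- Hilbert's Theorem 90 for `k(i)/k`. -/
theorem exists_apply_mul_eq {ω : AdjoinI k ≃ₐ[k] AdjoinI k} (hω : ω ≠ 1) {z : AdjoinI k}
    (hz : ω z * z = 1) : ∃ c : AdjoinI k, c ≠ 0 ∧ ω c * z = c := by
  by_cases h : 1 + z = 0
  · obtain ⟨i, hi⟩ := exists_sq_eq_neg_one k
    refine ⟨i, fun h0 => by simp [h0] at hi, ?_⟩
    rw [apply_eq_neg_of_ne_one hi hω]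
    linear_combination -i * h
  · exact ⟨1 + z, h, by rw [map_add, map_one]; linear_combination hz⟩

end Semireal

section RealClosed

variable [IsRealClosed k]

theorem isSquare_algebraMap (a : k) : IsSquare (algebraMap k (AdjoinI k) a) := by
  obtain ⟨i, hi⟩ := exists_sq_eq_neg_one k
  rcases IsRealClosed.isSquare_or_isSquare_neg a with h | ⟨c, hc⟩
  · exact h.map _
  · refine ⟨algebraMap k _ c * i, ?_⟩
    rw [← neg_neg a, hc, map_neg, map_mul]
    linear_combination -(algebraMap k (AdjoinI k) c) ^ 2 * hi

theorem isSquare (z : AdjoinI k) : IsSquare z := by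
  obtain ⟨i, hi⟩ := exists_sq_eq_neg_one k
  obtain ⟨a, b, rfl⟩ := exists_eq_add_mul hi z
  obtain rfl | hb := eq_or_ne b 0
  · simpa using isSquare_algebraMap a
  obtain ⟨r, hr⟩ := isSquare_sq_add_sq a b
  obtain ⟨w, hw⟩ := isSquare_algebraMap ((a + r) / 2)
  have : CharZero (AdjoinI k) :=
    charZero_of_injective_algebraMap (algebraMap k (AdjoinI k)).injective
  have hr' : (algebraMap k (AdjoinI k) a) ^ 2 + (algebraMap k _ b) ^ 2 = algebraMap k _ r ^ 2 := by
    rw [← map_pow, ← map_pow, ← map_add, hr, ← sq, map_pow]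
  have hw' : 2 * w ^ 2 = algebraMap k (AdjoinI k) a + algebraMap k _ r := by
    rw [sq w, ← hw, map_div₀, map_add, map_ofNat, mul_div_cancel₀ _ two_ne_zero]
  have hw0 : w ≠ 0 := by
    rintro rfl
    refine hb ((algebraMap k (AdjoinI k)).injective ?_)
    rw [map_zero, ← sq_eq_zero_iff]
    linear_combination hr' + (algebraMap k (AdjoinI k) r - algebraMap k _ a) * -hw'
  refine ⟨w + algebraMap k _ b / (2 * w) * i, ?_⟩
  field_simp
  linear_combination (2 * w ^ 2 - algebraMap k (AdjoinI k) a + algebraMap k _ r) * -hw' -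
    algebraMap k (AdjoinI k) b ^ 2 * hi + hr'

theorem finrank_eq_one (L : Type*) [Field L] [Algebra (AdjoinI k) L]
    [FiniteDimensional (AdjoinI k) L] : Module.finrank (AdjoinI k) L = 1 := by
  let : Algebra k L := Algebra.compHom L (algebraMap k (AdjoinI k))
  have : IsScalarTower k (AdjoinI k) L := .of_algebraMap_eq fun _ => rfl
  have : FiniteDimensional k L := .trans k (AdjoinI k) L
  let E := IntermediateField.normalClosure k L (AlgebraicClosure L)
  let : Algebra (AdjoinI k) E := Algebra.compHom E (algebraMap (AdjoinI k) L)
  have : IsScalarTower (AdjoinI k) L E := .of_algebraMap_eq fun _ => rfl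
  have : IsScalarTower k (AdjoinI k) E := .of_algebraMap_eq fun x => by
    rw [IsScalarTower.algebraMap_apply (AdjoinI k) L E,
      ← IsScalarTower.algebraMap_apply k (AdjoinI k) L, ← IsScalarTower.algebraMap_apply k L E]
  have : CharZero (AdjoinI k) :=
    charZero_of_injective_algebraMap (algebraMap k (AdjoinI k)).injective
  have : IsGalois k E := ⟨⟩
  have : IsGalois (AdjoinI k) E := .tower_top_of_isGalois k (AdjoinI k) E
  have : FiniteDimensional (AdjoinI k) E := .right k (AdjoinI k) E
  obtain ⟨n, hn⟩ := exists_finrank_eq_two_pow k E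
  obtain ⟨m, -, hm⟩ := (Nat.dvd_prime_pow Nat.prime_two).mp
    (hn ▸ Dvd.intro_left _ (Module.finrank_mul_finrank k (AdjoinI k) E))
  have hE := finrank_eq_one_of_finrank_eq_two_pow isSquare hm
  exact Nat.eq_one_of_mul_eq_one_right ((Module.finrank_mul_finrank (AdjoinI k) L E).trans hE)

instance isAlgClosed : IsAlgClosed (AdjoinI k) :=
  .of_exists_root _ fun p _ hp => by
    have : Fact (Irreducible p) := ⟨hp⟩
    have hdeg := (AdjoinRoot.powerBasis hp.ne_zero).finrank
    have := (AdjoinRoot.powerBasis hp.ne_zero).finite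
    rw [finrank_eq_one, AdjoinRoot.powerBasis_dim] at hdeg
    exact Polynomial.exists_root_of_degree_eq_one
      (Polynomial.degree_eq_iff_natDegree_eq_of_pos one_pos |>.mpr hdeg.symm)

end RealClosed

end AdjoinI

theorem nonempty_algEquiv_or_adjoinI (k Z : Type*) [Field k] [IsRealClosed k] [Field Z]
    [Algebra k Z] [Algebra.IsAlgebraic k Z] :
    Nonempty (Z ≃ₐ[k] k) ∨ Nonempty (Z ≃ₐ[k] AdjoinI k) :=
  IsAlgClosed.nonempty_algEquiv_or_of_finrank_eq_two Z AdjoinI.finrank_eq_two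

/-! ### Galois algebras: dimension and simple quotients -/

open scoped Pointwise TensorProduct

section Dimension

variable {k G A : Type*} [Field k] [Group G] [Ring A] [Algebra k A] [MulSemiringAction G A]
  [SMulCommClass G k A]

theorem galoisCanMap_tmul (x y : A) (g : G) : galoisCanMap k G A (x ⊗ₜ y) g = x * g • y := rfl

theorem card_le_finrank_of_surjective_galoisCanMap [Finite G] [Nontrivial A]
    [FiniteDimensional k A] (h : Function.Surjective (galoisCanMap k G A)) :
    Nat.card G ≤ Module.finrank k A := by
  cases nonempty_fintype G
  have h1 := LinearMap.finrank_le_finrank_of_surjective h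
  rw [Module.finrank_tensorProduct, Module.finrank_pi_fintype, Finset.sum_const, Finset.card_univ,
    smul_eq_mul, ← Nat.card_eq_fintype_card] at h1
  exact Nat.le_of_mul_le_mul_right h1 Module.finrank_pos

namespace IsGaloisAlgebra

theorem nontrivial (hA : IsGaloisAlgebra k G A) : Nontrivial A := by
  have := hA.faithfullyFlat
  exact (TensorProduct.lid k A).symm.toEquiv.nontrivial_congr.mpr inferInstance

theorem finiteDimensional [Finite G] (hA : IsGaloisAlgebra k G A) : FiniteDimensional k A := by
  have := hA.nontrivial
  let b := Algebra.TensorProduct.basis A (Module.Basis.ofVectorSpace k A)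
  let e : (A ⊗[k] A) →ₗ[A] (G → A) :=
    { galoisCanMap k G A with
      map_smul' := fun a t => by
        change galoisCanMap k G A (a • t) = a • galoisCanMap k G A t
        induction t with
        | zero => simp
        | add t t' h h' => rw [smul_add, map_add, map_add, smul_add, h, h']
        | tmul x y =>
          funext g
          rw [TensorProduct.smul_tmul', Pi.smul_apply, galoisCanMap_tmul, galoisCanMap_tmul,
            smul_eq_mul, smul_eq_mul, mul_assoc] }
  let e' : (A ⊗[k] A) ≃ₗ[A] (G → A) := LinearEquiv.ofBijective e hA.can_bijective
  have : Module.Finite A (A ⊗[k] A) := Module.Finite.equiv e'.symm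
  have := Module.Finite.finite_basis b
  exact Module.Finite.of_basis (Module.Basis.ofVectorSpace k A)

theorem isNoetherianRing [Finite G] (hA : IsGaloisAlgebra k G A) : IsNoetherianRing A :=
  have := hA.finiteDimensional
  isNoetherian_of_tower k inferInstance

theorem finrank_eq_card [Finite G] (hA : IsGaloisAlgebra k G A) :
    Module.finrank k A = Nat.card G := by
  cases nonempty_fintype G
  have := hA.nontrivial
  have := hA.finiteDimensional
  have h1 := (LinearEquiv.ofBijective _ hA.can_bijective).finrank_eq
  rw [Module.finrank_tensorProduct, Module.finrank_pi_fintype, Finset.sum_const, Finset.card_univ,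
    smul_eq_mul, ← Nat.card_eq_fintype_card] at h1
  exact Nat.eq_of_mul_eq_mul_right Module.finrank_pos h1

end IsGaloisAlgebra

end Dimension

section IdealAction

variable {G A : Type*} [Group G] [Ring A] [MulSemiringAction G A]

instance isTwoSided_smul (g : G) (M : Ideal A) [M.IsTwoSided] : (g • M).IsTwoSided := by
  rw [Ideal.pointwise_smul_eq_comap]
  infer_instance

theorem mem_iInf_smul_iff {M : Ideal A} {a : A} :
    a ∈ ⨅ g : G, g • M ↔ ∀ g : G, g • a ∈ M := by
  simp only [Submodule.mem_iInf, Ideal.mem_pointwise_smul_iff_inv_smul_mem]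
  exact ⟨fun h g => inv_inv g ▸ h g⁻¹, fun h g => h g⁻¹⟩

theorem smul_iInf_smul (M : Ideal A) (h : G) : h • ⨅ g : G, g • M = ⨅ g : G, g • M := by
  ext a
  rw [Ideal.mem_pointwise_smul_iff_inv_smul_mem, mem_iInf_smul_iff, mem_iInf_smul_iff]
  refine ⟨fun ha g => ?_, fun ha g => ?_⟩
  · simpa only [mul_smul, smul_inv_smul] using ha (g * h)
  · simpa only [mul_smul] using ha (g * h⁻¹)

theorem smul_mem_iff_of_mem_stabilizer {M : Ideal A} {g : G} (hg : g ∈ MulAction.stabilizer G M)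
    {a : A} : g • a ∈ M ↔ a ∈ M := by
  conv_lhs => rw [← MulAction.mem_stabilizer_iff.mp hg, Ideal.smul_mem_pointwise_smul_iff]

instance smulCommClass_ideal {Γ : Type*} [Group Γ] [MulSemiringAction Γ A] [SMulCommClass Γ G A] :
    SMulCommClass Γ G (Ideal A) where
  smul_comm φ g M := by
    ext a
    simp only [Ideal.mem_pointwise_smul_iff_inv_smul_mem, smul_comm φ⁻¹ g⁻¹ a]

variable (M : Ideal A) [M.IsTwoSided]

instance quotientStabilizerAction :
    MulSemiringAction (MulAction.stabilizer G M) (A ⧸ M) where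
  smul s := Ideal.quotientMap M (MulSemiringAction.toRingHom G A s.1)
    fun _ ha => (smul_mem_iff_of_mem_stabilizer s.2).mpr ha
  one_smul b := by
    obtain ⟨a, rfl⟩ := Ideal.Quotient.mk_surjective b
    exact congrArg (Ideal.Quotient.mk M) (one_smul G a)
  mul_smul s t b := by
    obtain ⟨a, rfl⟩ := Ideal.Quotient.mk_surjective b
    exact congrArg (Ideal.Quotient.mk M) (mul_smul s.1 t.1 a)
  smul_zero s := map_zero (Ideal.quotientMap M _ _)
  smul_add s := map_add (Ideal.quotientMap M _ _)
  smul_one s := map_one (Ideal.quotientMap M _ _)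
  smul_mul s := map_mul (Ideal.quotientMap M _ _)

theorem smul_quotient_mk (s : MulAction.stabilizer G M) (a : A) :
    s • Ideal.Quotient.mk M a = Ideal.Quotient.mk M (s.1 • a) := rfl

variable {k : Type*} [Field k] [Algebra k A] [SMulCommClass G k A]

instance smulCommClass_quotientStabilizer :
    SMulCommClass (MulAction.stabilizer G M) k (A ⧸ M) where
  smul_comm s c b := by
    obtain ⟨a, rfl⟩ := Ideal.Quotient.mk_surjective b
    exact congrArg (Ideal.Quotient.mk M) (smul_comm s.1 c a)

namespace IsGaloisAlgebra

theorem surjective_galoisCanMap_quotient (hA : IsGaloisAlgebra k G A) :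
    Function.Surjective (galoisCanMap k (MulAction.stabilizer G M) (A ⧸ M)) := by
  classical
  intro f
  choose c hc using fun s => Ideal.Quotient.mk_surjective (f s)
  obtain ⟨t, ht⟩ := hA.can_bijective.2
    (fun g => if hg : g ∈ MulAction.stabilizer G M then c ⟨g, hg⟩ else 0)
  let π : A →ₗ[k] A ⧸ M := (Ideal.Quotient.mkₐ k M).toLinearMap
  have can_map : ∀ t (s : MulAction.stabilizer G M),
      galoisCanMap k (MulAction.stabilizer G M) (A ⧸ M) (TensorProduct.map π π t) s =
        π (galoisCanMap k G A t s.1) := fun t s => by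
    induction t with
    | zero => simp
    | add t t' h h' => simp only [map_add, Pi.add_apply, h, h']
    | tmul x y =>
      rw [TensorProduct.map_tmul, galoisCanMap_tmul, galoisCanMap_tmul]
      exact (map_mul (Ideal.Quotient.mk M) x (s.1 • y)).symm
  refine ⟨TensorProduct.map π π t, funext fun s => ?_⟩
  rw [can_map, ht]
  simp only [s.2, dite_true]
  exact hc s

variable {M} [Finite G]

theorem eq_bot_of_forall_smul_eq (hA : IsGaloisAlgebra k G A) (hM : M ≠ ⊤)
    (hstab : ∀ g : G, g • M = M) : M = ⊥ := by
  have := hA.finiteDimensional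
  have : Nontrivial (A ⧸ M) := Ideal.Quotient.nontrivial_iff.mpr hM
  have hle := card_le_finrank_of_surjective_galoisCanMap (hA.surjective_galoisCanMap_quotient M)
  have htop : MulAction.stabilizer G M = ⊤ := (Subgroup.eq_top_iff' _).mpr hstab
  rw [htop, Subgroup.card_top, ← hA.finrank_eq_card] at hle
  have hsurj : Function.Surjective (Ideal.Quotient.mkₐ k M).toLinearMap :=
    Ideal.Quotient.mkₐ_surjective k M
  have hinj := (LinearMap.injective_iff_surjective_of_finrank_eq_finrank (le_antisymm hle
    (LinearMap.finrank_le_finrank_of_surjective hsurj))).mpr hsurj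
  refine (Submodule.eq_bot_iff M).mpr fun a ha => hinj ?_
  exact (Ideal.Quotient.eq_zero_iff_mem.mpr ha).trans (map_zero (Ideal.Quotient.mk M)).symm

theorem iInf_smul_eq_bot (hA : IsGaloisAlgebra k G A) (hM : M ≠ ⊤) : ⨅ g : G, g • M = ⊥ := by
  refine hA.eq_bot_of_forall_smul_eq (fun h => hM ?_) (smul_iInf_smul M)
  exact (one_smul G M).symm.trans (iInf_eq_top.mp h 1)

theorem eq_zero_of_forall_smul_mem (hA : IsGaloisAlgebra k G A) (hM : M ≠ ⊤) {a : A}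
    (ha : ∀ g : G, g • a ∈ M) : a = 0 := by
  rwa [← mem_iInf_smul_iff, hA.iInf_smul_eq_bot hM] at ha

end IsGaloisAlgebra

end IdealAction

/-! ### Maximal two-sided ideals -/

/-- `M` is maximal among the proper two-sided ideals of `A`, where two-sided ideals are encoded as
left ideals satisfying `Ideal.IsTwoSided` so that `A ⧸ M` is available as a ring. -/
class IsMaximalTwoSided {A : Type*} [Ring A] (M : Ideal A) : Prop extends M.IsTwoSided where
  ne_top : M ≠ ⊤
  eq_of_le : ∀ I : Ideal A, I.IsTwoSided → M ≤ I → I ≠ ⊤ → I = M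

theorem exists_isMaximalTwoSided (A : Type*) [Ring A] [Nontrivial A] [IsNoetherianRing A] :
    ∃ M : Ideal A, IsMaximalTwoSided M := by
  obtain ⟨M, ⟨htwo, hne⟩, hmax⟩ := WellFounded.has_min
    (r := ((· > ·) : Ideal A → Ideal A → Prop))
    wellFounded_gt {I | I.IsTwoSided ∧ I ≠ ⊤} ⟨⊥, inferInstance, bot_ne_top⟩
  exact ⟨M, { htwo with
    ne_top := hne
    eq_of_le := fun I hI hle hI' => by_contra fun h =>
      hmax I ⟨hI, hI'⟩ (lt_of_le_of_ne hle (Ne.symm h)) }⟩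

namespace IsMaximalTwoSided

variable {A : Type*} [Ring A]

instance (M : Ideal A) [hM : IsMaximalTwoSided M] : Nontrivial (A ⧸ M) :=
  Ideal.Quotient.nontrivial_iff.mpr hM.ne_top

instance isSimpleRing_quotient (M : Ideal A) [hM : IsMaximalTwoSided M] :
    IsSimpleRing (A ⧸ M) := by
  refine isSimpleRing_iff_isTwoSided_imp.mpr ⟨inferInstance, fun J hJ => ?_⟩
  have hsurj := Ideal.Quotient.mk_surjective (I := M)
  have hle : M ≤ J.comap (Ideal.Quotient.mk M) := fun a ha => by
    rw [Ideal.mem_comap, Ideal.Quotient.eq_zero_iff_mem.mpr ha]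
    exact J.zero_mem
  rw [← Ideal.map_comap_of_surjective _ hsurj J]
  by_cases htop : J.comap (Ideal.Quotient.mk M) = ⊤
  · exact Or.inr (htop ▸ Ideal.map_top _)
  · left
    rw [hM.eq_of_le _ inferInstance hle htop, Ideal.map_quotient_self]

instance smul {G : Type*} [Group G] [MulSemiringAction G A] (g : G) (M : Ideal A)
    [hM : IsMaximalTwoSided M] : IsMaximalTwoSided (g • M) where
  toIsTwoSided := inferInstance
  ne_top h := hM.ne_top ((Ideal.eq_top_iff_one M).mpr (by
    rw [← Ideal.smul_mem_pointwise_smul_iff (a := g), h]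
    exact Submodule.mem_top))
  eq_of_le I hI hle hne := by
    refine smul_left_cancel g⁻¹ ((hM.eq_of_le (g⁻¹ • I) inferInstance
      (Ideal.pointwise_smul_subset_iff.mp hle) fun h => hne ?_).trans (inv_smul_smul g M).symm)
    rw [Ideal.eq_top_iff_one, ← smul_one g⁻¹, ← Ideal.smul_mem_pointwise_smul_iff (a := g⁻¹)]
    simp [h]

theorem sup_eq_top {M N : Ideal A} [hM : IsMaximalTwoSided M] [hN : IsMaximalTwoSided N]
    (h : N ≠ M) : N ⊔ M = ⊤ := by
  have htwo : (N ⊔ M).IsTwoSided := ⟨fun {a} b ha => by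
    obtain ⟨x, hx, y, hy, rfl⟩ := Submodule.mem_sup.mp ha
    rw [add_mul]
    exact Submodule.add_mem_sup (Ideal.mul_mem_right _ _ hx) (Ideal.mul_mem_right _ _ hy)⟩
  by_contra hne
  exact h ((hN.eq_of_le _ htwo le_sup_left hne).symm.trans (hM.eq_of_le _ htwo le_sup_right hne))

/-- If `e ∈ sInf s` and `f ∈ N` are congruent to `1` modulo `M`, so is `e * f`, which lies in both
ideals. -/
theorem sInf_sup_eq_top {M : Ideal A} [IsMaximalTwoSided M] {s : Set (Ideal A)} (hs : s.Finite)
    (hmax : ∀ N ∈ s, IsMaximalTwoSided N) (hne : ∀ N ∈ s, N ≠ M) : sInf s ⊔ M = ⊤ := by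
  induction s, hs using Set.Finite.induction_on with
  | empty => simp
  | @insert N s _ _ ih =>
    have hN := hmax N (Set.mem_insert N s)
    have htwo : ∀ J ∈ s, J.IsTwoSided := fun J hJ => (hmax J (Set.mem_insert_of_mem N hJ)).1
    have ih := ih (fun J hJ => hmax J (Set.mem_insert_of_mem N hJ))
      fun J hJ => hne J (Set.mem_insert_of_mem N hJ)
    obtain ⟨e, he, m, hm, hem⟩ := Submodule.mem_sup.mp ((Ideal.eq_top_iff_one _).mp ih)
    obtain ⟨f, hf, n, hn, hfn⟩ := Submodule.mem_sup.mp
      ((Ideal.eq_top_iff_one _).mp (sup_eq_top (hne N (Set.mem_insert N s))))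
    have hefs : e * f ∈ sInf s := Submodule.mem_sInf.mpr fun J hJ => by
      have := htwo J hJ
      exact Ideal.mul_mem_right f J (Submodule.mem_sInf.mp he J hJ)
    refine (Ideal.eq_top_iff_one _).mpr (Submodule.mem_sup.mpr
      ⟨e * f, ?_, m + e * n, M.add_mem hm (M.mul_mem_left e hn), ?_⟩)
    · rw [sInf_insert]
      exact ⟨N.mul_mem_left e hf, hefs⟩
    · rw [add_left_comm, ← mul_add, hfn, mul_one, add_comm, hem]

end IsMaximalTwoSided

/-! ### The simple quotient of a Galois algebra -/

instance smulCommClass_equivariantAut {k G A : Type*} [Field k] [Group G] [Ring A] [Algebra k A]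
    [MulSemiringAction G A] : SMulCommClass (equivariantAut k G A) G A where
  smul_comm φ := φ.2

theorem card_stabilizer_mul_ncard_orbit (G : Type*) {X : Type*} [Group G] [MulAction G X] (x : X) :
    Nat.card (MulAction.stabilizer G x) * (MulAction.orbit G x).ncard = Nat.card G := by
  rw [← MulAction.index_stabilizer, Subgroup.card_mul_index]

/-- The `S`-algebra `B` is isomorphic to each of its conjugates under `G`: for every `g`, some
automorphism of `B` turns the action of `s` into that of `g s g⁻¹`, whenever both lie in `S`. -/
def IsConjStable (k : Type*) {G : Type*} [Field k] [Group G] (S : Subgroup G) (B : Type*) [Ring B]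
    [Algebra k B] [MulSemiringAction S B] : Prop :=
  ∀ g : G, ∃ ψ : B ≃ₐ[k] B, ∀ s t : S, t.1 = g * s.1 * g⁻¹ → ∀ b, ψ (s • b) = t • ψ b

namespace IsGaloisAlgebra

variable {k G A : Type*} [Field k] [Group G] [Finite G] [Ring A] [Algebra k A]
  [MulSemiringAction G A] {M : Ideal A} [hM : IsMaximalTwoSided M]

theorem exists_mk_eq_one_of_smul_mem :
    ∃ e : A, Ideal.Quotient.mk M e = 1 ∧
      ∀ g : G, g ∉ MulAction.stabilizer G M → g • e ∈ M := by
  have htop := IsMaximalTwoSided.sInf_sup_eq_top (M := M)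
    (s := {N ∈ MulAction.orbit G M | N ≠ M}) ((Set.finite_range _).subset fun _ h => h.1)
    (by rintro _ ⟨⟨g, rfl⟩, -⟩; exact IsMaximalTwoSided.smul g M) fun _ h => h.2
  obtain ⟨e, he, m, hm, hem⟩ := Submodule.mem_sup.mp ((Ideal.eq_top_iff_one _).mp htop)
  refine ⟨e, ?_, fun g hg => Ideal.mem_inv_pointwise_smul_iff.mp (Submodule.mem_sInf.mp he _
    ⟨⟨g⁻¹, rfl⟩, fun h => hg (inv_mem_iff.mp h)⟩)⟩
  rw [← map_one (Ideal.Quotient.mk M), ← hem, map_add, Ideal.Quotient.eq_zero_iff_mem.mpr hm,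
    add_zero]

theorem exists_mk_smul_eq (b : G ⧸ MulAction.stabilizer G M → A ⧸ M) :
    ∃ a : A, ∀ t, Ideal.Quotient.mk M (t.out⁻¹ • a) = b t := by
  classical
  cases nonempty_fintype G
  obtain ⟨e, hone, he⟩ := exists_mk_eq_one_of_smul_mem (G := G) (M := M)
  choose c hc using fun t => Ideal.Quotient.mk_surjective (b t)
  refine ⟨∑ t : G ⧸ MulAction.stabilizer G M, t.out • (e * c t), fun t => ?_⟩
  rw [Finset.smul_sum, map_sum, Finset.sum_eq_single t]
  · rw [inv_smul_smul, map_mul, hone, one_mul, hc]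
  · intro t' _ ht'
    rw [smul_smul, smul_mul', Ideal.Quotient.eq_zero_iff_mem]
    refine M.mul_mem_right _ (he _ fun h => ht' ?_)
    rw [← t.out_eq', ← t'.out_eq']
    exact (QuotientGroup.eq.mpr h).symm
  · simp

variable [SMulCommClass G k A]

theorem finrank_quotient_eq_card (hA : IsGaloisAlgebra k G A) :
    Module.finrank k (A ⧸ M) = Nat.card (MulAction.stabilizer G M) := by
  cases nonempty_fintype G
  classical
  have := hA.finiteDimensional
  refine le_antisymm ?_ (card_le_finrank_of_surjective_galoisCanMap
    (hA.surjective_galoisCanMap_quotient M))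
  let f : A →ₗ[k] (G ⧸ MulAction.stabilizer G M → A ⧸ M) :=
    LinearMap.pi fun t => (Ideal.Quotient.mkₐ k M).toLinearMap ∘ₗ
      DistribSMul.toLinearMap k A t.out⁻¹
  have hf : Function.Surjective f := fun b => by
    obtain ⟨a, ha⟩ := exists_mk_smul_eq b
    exact ⟨a, funext ha⟩
  have h1 := LinearMap.finrank_le_finrank_of_surjective hf
  rw [Module.finrank_pi_fintype, Finset.sum_const, Finset.card_univ, smul_eq_mul,
    hA.finrank_eq_card, ← Nat.card_eq_fintype_card, ← Subgroup.index,
    ← (MulAction.stabilizer G M).index_mul_card] at h1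
  exact Nat.le_of_mul_le_mul_left h1 (Nat.pos_of_ne_zero Subgroup.index_ne_zero_of_finite)

variable (k M) in
/-- The `G`-equivariant homomorphism `A → Ind_S^G(A ⧸ M)`, `a ↦ (g ↦ g • a mod M)`, where `S` is
the stabilizer of the two-sided ideal `M`. -/
def toInduced {G A : Type*} [Group G] [Ring A] [Algebra k A] [MulSemiringAction G A]
    [SMulCommClass G k A] (M : Ideal A) [M.IsTwoSided] :
    A →ₐ[k] inducedAlgebra k (MulAction.stabilizer G M) (A ⧸ M) where
  toFun a := ⟨fun g => Ideal.Quotient.mk M (g • a), fun s g => by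
    rw [smul_quotient_mk, ← mul_smul]⟩
  map_one' := Subtype.ext (funext fun g => by simp)
  map_mul' a b := Subtype.ext (funext fun g => by simp [smul_mul'])
  map_zero' := Subtype.ext (funext fun g => by simp)
  map_add' a b := Subtype.ext (funext fun g => by simp)
  commutes' c := Subtype.ext (funext fun g => by simp only [smul_algebraMap]; rfl)

omit [Finite G] in
theorem toInduced_apply (a : A) (g : G) :
    (toInduced k M a).1 g = Ideal.Quotient.mk M (g • a) := rfl

theorem toInduced_injective (hA : IsGaloisAlgebra k G A) :
    Function.Injective (toInduced k (G := G) M) :=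
  (injective_iff_map_eq_zero _).mpr fun a ha => hA.eq_zero_of_forall_smul_mem hM.ne_top fun g => by
    rw [← Ideal.Quotient.eq_zero_iff_mem, ← toInduced_apply (k := k), ha]
    rfl

theorem toInduced_surjective : Function.Surjective (toInduced k (G := G) M) := fun r => by
  obtain ⟨a, ha⟩ := exists_mk_smul_eq (G := G) fun t => r.1 t.out⁻¹
  refine ⟨a, Subtype.ext (funext fun g => ?_)⟩
  set t : G ⧸ MulAction.stabilizer G M := QuotientGroup.mk g⁻¹
  have hs : g * t.out ∈ MulAction.stabilizer G M := by
    have h : QuotientGroup.mk g⁻¹ = QuotientGroup.mk t.out := t.out_eq'.symm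
    simpa using QuotientGroup.eq.mp h
  have hg : g = (⟨g * t.out, hs⟩ : MulAction.stabilizer G M).1 * t.out⁻¹ := by simp
  rw [hg, r.2, (toInduced k M a).2, toInduced_apply, ha]

theorem isomorphic_inducedAlgebra (hA : IsGaloisAlgebra k G A) (M : Ideal A)
    [IsMaximalTwoSided M] :
    GAlgIsomorphic k G A (inducedAlgebra k (MulAction.stabilizer G M) (A ⧸ M)) :=
  ⟨AlgEquiv.ofBijective (toInduced k M) ⟨hA.toInduced_injective, toInduced_surjective⟩,
    fun g a => Subtype.ext (funext fun x =>
      congrArg (Ideal.Quotient.mk M) (mul_smul x g a).symm)⟩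

theorem quotient (hA : IsGaloisAlgebra k G A) (M : Ideal A) [IsMaximalTwoSided M] :
    IsGaloisAlgebra k (MulAction.stabilizer G M) (A ⧸ M) where
  faithfullyFlat := inferInstance
  invariants := fun b => by
    refine ⟨fun hb => ?_, ?_⟩
    · obtain ⟨f, hf⟩ := hA.isomorphic_inducedAlgebra M
      let r : inducedAlgebra k (MulAction.stabilizer G M) (A ⧸ M) :=
        ⟨fun _ => b, fun s _ => (hb s).symm⟩
      obtain ⟨c, hc⟩ := (hA.invariants (f.symm r)).mp fun g => f.injective (by
        rw [hf, f.apply_symm_apply]; rfl)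
      refine ⟨c, ?_⟩
      have h := congrArg f hc
      rw [f.apply_symm_apply, f.commutes] at h
      exact congrFun (congrArg Subtype.val h) 1
    · rintro ⟨c, rfl⟩ s
      exact smul_algebraMap s c
  can_bijective := by
    have := hA.finiteDimensional
    cases nonempty_fintype G
    classical
    have h := hA.surjective_galoisCanMap_quotient M
    refine ⟨(LinearMap.injective_iff_surjective_of_finrank_eq_finrank ?_).mpr h, h⟩
    rw [Module.finrank_tensorProduct, Module.finrank_pi_fintype, Finset.sum_const,
      Finset.card_univ, smul_eq_mul, ← Nat.card_eq_fintype_card, hA.finrank_quotient_eq_card]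

theorem mem_orbit_of_isMaximalTwoSided (hA : IsGaloisAlgebra k G A) (M N : Ideal A)
    [hM : IsMaximalTwoSided M] [hN : IsMaximalTwoSided N] : N ∈ MulAction.orbit G M := by
  by_contra h
  have htop := IsMaximalTwoSided.sInf_sup_eq_top (M := N) (Set.finite_range (· • M : G → _))
    (by rintro _ ⟨g, rfl⟩; exact IsMaximalTwoSided.smul g M) (fun _ hN h' => h (h' ▸ hN))
  rw [sInf_range, hA.iInf_smul_eq_bot hM.ne_top, bot_sup_eq] at htop
  exact hN.ne_top htop

theorem orbit_subset_orbit (hA : IsGaloisAlgebra k G A) (Γ : Type*) [Group Γ]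
    [MulSemiringAction Γ A] (M : Ideal A) [IsMaximalTwoSided M] :
    MulAction.orbit Γ M ⊆ MulAction.orbit G M := by
  rintro _ ⟨φ, rfl⟩
  exact hA.mem_orbit_of_isMaximalTwoSided M (φ • M)

theorem card_stabilizer_le_card_stabilizer (hA : IsGaloisAlgebra k G A) {Γ : Type*} [Group Γ]
    [MulSemiringAction Γ A] (hcard : Nat.card Γ = Nat.card G) :
    Nat.card (MulAction.stabilizer G M) ≤ Nat.card (MulAction.stabilizer Γ M) := by
  have hle := Set.ncard_le_ncard (hA.orbit_subset_orbit Γ M) (Set.finite_range _)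
  have hpos : 0 < (MulAction.orbit G M).ncard :=
    (Set.ncard_pos (Set.finite_range _)).mpr (MulAction.nonempty_orbit M)
  refine Nat.le_of_mul_le_mul_right ?_ hpos
  rw [card_stabilizer_mul_ncard_orbit, ← hcard, ← card_stabilizer_mul_ncard_orbit Γ M]
  exact Nat.mul_le_mul_left _ hle

section Automorphisms

variable {Γ : Type*} [Group Γ] [MulSemiringAction Γ A] [SMulCommClass Γ G A]
  [SMulCommClass Γ k A]

variable (k G Γ) in
/-- The `S`-equivariant automorphism of `A ⧸ M` induced by an element of a group `Γ` that stabilizes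
`M` and acts on `A` by `G`-equivariant automorphisms, where `S` is the stabilizer of `M` in `G`. -/
def quotientAut {A : Type*} [Ring A] [Algebra k A] [MulSemiringAction G A]
    [MulSemiringAction Γ A] [SMulCommClass Γ G A] [SMulCommClass Γ k A] (M : Ideal A)
    [M.IsTwoSided] (τ : MulAction.stabilizer Γ M) :
    equivariantAut k (MulAction.stabilizer G M) (A ⧸ M) :=
  ⟨MulSemiringAction.toAlgEquiv k (A ⧸ M) τ, fun s b => by
    obtain ⟨a, rfl⟩ := Ideal.Quotient.mk_surjective b
    exact congrArg (Ideal.Quotient.mk M) (smul_comm τ.1 s.1 a)⟩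

theorem quotientAut_injective [FaithfulSMul Γ A] (hA : IsGaloisAlgebra k G A) :
    Function.Injective (quotientAut k G Γ M) := fun τ τ' h => by
  refine Subtype.ext (eq_of_smul_eq_smul fun a => sub_eq_zero.mp
    (hA.eq_zero_of_forall_smul_mem hM.ne_top fun g => ?_))
  have hg : Ideal.Quotient.mk M (τ.1 • g • a) = Ideal.Quotient.mk M (τ'.1 • g • a) :=
    congrArg (fun φ => φ.1 (Ideal.Quotient.mk M (g • a))) h
  rw [smul_comm, smul_comm _ g] at hg
  rw [smul_sub]
  exact Ideal.Quotient.eq.mp hg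

variable (hA : IsGaloisAlgebra k G A) (hcard : Nat.card Γ = Nat.card G)

include hA hcard

variable [FaithfulSMul Γ A] [Finite (equivariantAut k (MulAction.stabilizer G M) (A ⧸ M))]

theorem card_stabilizer_le_card_equivariantAut_quotient :
    Nat.card (MulAction.stabilizer G M) ≤
      Nat.card (equivariantAut k (MulAction.stabilizer G M) (A ⧸ M)) :=
  (hA.card_stabilizer_le_card_stabilizer hcard).trans
    (Nat.card_le_card_of_injective _ hA.quotientAut_injective)

variable (hle : Nat.card (equivariantAut k (MulAction.stabilizer G M) (A ⧸ M)) ≤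
  Nat.card (MulAction.stabilizer G M))

include hle

theorem exists_smul_smul_eq (g : G) : ∃ φ : Γ, φ • g • M = M := by
  have hstab : Nat.card (MulAction.stabilizer Γ M) = Nat.card (MulAction.stabilizer G M) :=
    le_antisymm ((Nat.card_le_card_of_injective _ hA.quotientAut_injective).trans hle)
      (hA.card_stabilizer_le_card_stabilizer hcard)
  have horb := hcard
  rw [← card_stabilizer_mul_ncard_orbit _ M, ← card_stabilizer_mul_ncard_orbit G M, hstab] at horb
  have hmem : g • M ∈ MulAction.orbit Γ M := by
    rw [Set.eq_of_subset_of_ncard_le (hA.orbit_subset_orbit Γ M)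
      (Nat.eq_of_mul_eq_mul_left Nat.card_pos horb).ge (Set.finite_range _)]
    exact ⟨g, rfl⟩
  obtain ⟨φ, hφ⟩ := hmem
  exact ⟨φ⁻¹, inv_smul_eq_iff.mpr hφ.symm⟩

theorem stabilizer_normal : (MulAction.stabilizer G M).Normal where
  conj_mem s hs g := by
    obtain ⟨φ, hφ⟩ := hA.exists_smul_smul_eq hcard hle g⁻¹
    refine smul_left_cancel φ ?_
    rw [mul_smul, mul_smul, smul_comm φ g, smul_comm φ s, hφ, MulAction.mem_stabilizer_iff.mp hs,
      eq_comm, ← inv_smul_eq_iff, ← smul_comm, hφ]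

theorem isConjStable_quotient : IsConjStable k (MulAction.stabilizer G M) (A ⧸ M) := fun g => by
  obtain ⟨φ, hφ⟩ := hA.exists_smul_smul_eq hcard hle g
  let f : A ≃ₐ[k] A :=
    (MulSemiringAction.toAlgEquiv k A g).trans (MulSemiringAction.toAlgEquiv k A φ)
  have hf : ∀ a, f a = φ • g • a := fun _ => rfl
  have hmap : M = M.map (f : A →+* A) := by
    conv_lhs => rw [← hφ, Ideal.pointwise_smul_def, Ideal.pointwise_smul_def, Ideal.map_map]
    rfl
  refine ⟨Ideal.quotientEquivAlg M M f hmap, fun s t hst b => ?_⟩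
  obtain ⟨a, rfl⟩ := Ideal.Quotient.mk_surjective b
  change Ideal.Quotient.mk M (f (s.1 • a)) = Ideal.Quotient.mk M (t.1 • f a)
  rw [hf, hf, hst, ← smul_comm φ, smul_smul, smul_smul, inv_mul_cancel_right]

end Automorphisms

end IsGaloisAlgebra

/-! ### Simple Galois algebras: conjugators -/

/-- `u` implements the action of `s` by conjugation: `(s • z) u = u z` for all `z`. For a Galois
algebra, these `u` form the homogeneous component of degree `s` of a grading by `S`. -/
def IsConjugator {S B : Type*} [Group S] [Ring B] [MulSemiringAction S B] (s : S) (u : B) : Prop :=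
  ∀ z : B, s • z * u = u * z

namespace IsConjugator

variable {S B : Type*} [Group S] [Ring B] [MulSemiringAction S B] {s t : S} {u v : B}

theorem one : IsConjugator (1 : S) (1 : B) := fun z => by rw [one_smul, mul_one, one_mul]

theorem mul (hu : IsConjugator s u) (hv : IsConjugator t v) : IsConjugator (s * t) (u * v) :=
  fun z => by rw [mul_smul, ← mul_assoc, hu, mul_assoc, hv, mul_assoc]

theorem smul {K : Type*} [CommSemiring K] [Algebra K B] (hu : IsConjugator s u) (α : K) :
    IsConjugator s (α • u) := fun z => by rw [mul_smul_comm, hu, smul_mul_assoc]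

theorem map {T C : Type*} [Group T] [Ring C] [MulSemiringAction T C] {t : T}
    (hu : IsConjugator s u) (φ : B ≃+* C) (hφ : ∀ b, φ (s • b) = t • φ b) :
    IsConjugator t (φ u) := fun z => by
  obtain ⟨w, rfl⟩ := φ.surjective z
  rw [← hφ, ← map_mul, hu, map_mul]

theorem act (hu : IsConjugator s u) (g : S) : IsConjugator (g * s * g⁻¹) (g • u) :=
  hu.map (MulSemiringAction.toRingEquiv S B g) fun b => by
    simp only [MulSemiringAction.toRingEquiv_apply_apply, mul_smul, inv_smul_smul]

theorem isUnit [IsSimpleRing B] [IsDedekindFiniteMonoid B] (hu : IsConjugator s u) (h0 : u ≠ 0) :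
    IsUnit u := by
  have : (Ideal.span {u}).IsTwoSided := ⟨fun {a} b ha => by
    obtain ⟨z, rfl⟩ := Ideal.mem_span_singleton'.mp ha
    exact Ideal.mem_span_singleton'.mpr ⟨z * s • b, by rw [mul_assoc, hu, mul_assoc]⟩⟩
  have hspan : Ideal.span {u} = ⊤ :=
    ((isSimpleRing_iff_isTwoSided_imp.mp inferInstance).2 _ this).resolve_left fun h =>
      h0 (Ideal.span_singleton_eq_bot.mp h)
  obtain ⟨z, hz⟩ := Ideal.mem_span_singleton'.mp ((Ideal.eq_top_iff_one _).mp hspan)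
  exact ⟨⟨u, z, mul_eq_one_comm.mp hz, hz⟩, rfl⟩

end IsConjugator

namespace IsGaloisAlgebra

variable {k S B : Type*} [Field k] [Group S] [Fintype S] [Ring B] [Algebra k B]
  [MulSemiringAction S B] [SMulCommClass S k B]

variable (k S B) in
/-- `(b_s)_s` is sent to the endomorphism `y ↦ ∑ s, (s • y) b_s`. For a Galois algebra this is
bijective, and the coefficients of `y ↦ b y` decompose `b` into conjugators. -/
def toEnd : (S → B) →ₗ[k] (B →ₗ[k] B) :=
  LinearMap.mk₂ k (fun b y => ∑ s : S, s • y * b s)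
    (by intro b b' y; simp [mul_add, Finset.sum_add_distrib])
    (by intro c b y; simp [Finset.smul_sum])
    (by intro b y y'; simp [add_mul, Finset.sum_add_distrib])
    (by intro c b y; simp [Finset.smul_sum, smul_comm _ c])

theorem toEnd_apply (b : S → B) (y : B) : toEnd k S B b y = ∑ s : S, s • y * b s := rfl

theorem toEnd_injective (hB : IsGaloisAlgebra k S B) : Function.Injective (toEnd k S B) := by
  classical
  refine (injective_iff_map_eq_zero _).mpr fun b hb => funext fun s => ?_
  have sum_galoisCanMap_mul : ∀ t, ∑ s : S, galoisCanMap k S B t s * b s = 0 := fun t => by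
    induction t with
    | zero => simp
    | add t t' h h' =>
      simp only [map_add, Pi.add_apply, add_mul, Finset.sum_add_distrib, h, h', add_zero]
    | tmul x y =>
      have h : ∑ s : S, s • y * b s = 0 := by rw [← toEnd_apply (k := k), hb]; rfl
      simp only [galoisCanMap_tmul, mul_assoc]
      rw [← Finset.mul_sum, h, mul_zero]
  obtain ⟨t, ht⟩ := hB.can_bijective.2 (Pi.single s 1)
  have h := sum_galoisCanMap_mul t
  rw [ht, Finset.sum_eq_single s (by intro t _ hts; simp [Pi.single_eq_of_ne hts]) (by simp)] at h
  simpa using h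

theorem toEnd_surjective (hB : IsGaloisAlgebra k S B) : Function.Surjective (toEnd k S B) := by
  have := hB.finiteDimensional
  refine (LinearMap.injective_iff_surjective_of_finrank_eq_finrank ?_).mp hB.toEnd_injective
  rw [Module.finrank_pi_fintype, Finset.sum_const, Finset.card_univ, smul_eq_mul,
    ← Nat.card_eq_fintype_card, Module.finrank_linearMap, hB.finrank_eq_card]

theorem exists_sum_conjugators (hB : IsGaloisAlgebra k S B) (b : B) :
    ∃ c : S → B, (∀ s, IsConjugator s (c s)) ∧ ∑ s, c s = b := by
  obtain ⟨c, hc⟩ := hB.toEnd_surjective (LinearMap.mulLeft k b)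
  have sum_smul_mul : ∀ y, ∑ s : S, s • y * c s = b * y := fun y => by
    rw [← toEnd_apply (k := k), hc, LinearMap.mulLeft_apply]
  refine ⟨c, fun s z => ?_, by simpa using sum_smul_mul 1⟩
  -- both sides are the `s`-th coefficient of `y ↦ b y z`
  have h : toEnd k S B (fun s => s • z * c s - c s * z) = 0 := by
    ext y
    have hyz := sum_smul_mul (y * z)
    rw [← mul_assoc, ← sum_smul_mul y, Finset.sum_mul] at hyz
    simp only [toEnd_apply, LinearMap.zero_apply, mul_sub, Finset.sum_sub_distrib, ← mul_assoc]
    rw [sub_eq_zero, ← hyz]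
    simp only [smul_mul']
  exact sub_eq_zero.mp (congrFun ((map_eq_zero_iff _ hB.toEnd_injective).mp h) s)

theorem eq_zero_of_sum_conjugators (hB : IsGaloisAlgebra k S B) {c : S → B}
    (hc : ∀ s, IsConjugator s (c s)) (h : ∑ s, c s = 0) : c = 0 := by
  refine (map_eq_zero_iff _ hB.toEnd_injective).mp (LinearMap.ext fun y => ?_)
  rw [toEnd_apply, LinearMap.zero_apply, Finset.sum_congr rfl fun s _ => hc s y, ← Finset.sum_mul,
    h, zero_mul]

end IsGaloisAlgebra

namespace IsGaloisAlgebra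

variable {k K S B : Type*} [Field k] [Group S] [Finite S] [Ring B] [Algebra k B]
  [MulSemiringAction S B] [SMulCommClass S k B] [Field K] [Algebra K B]

variable (K) in
theorem linearIndependent_conjugators (hB : IsGaloisAlgebra k S B) {ι : Type*} {j : ι → S}
    (hj : Function.Injective j) {u : ι → B} (h0 : ∀ x, u x ≠ 0)
    (hu : ∀ x, IsConjugator (j x) (u x)) : LinearIndependent K u := by
  classical
  cases nonempty_fintype S
  have := Finite.of_injective j hj
  cases nonempty_fintype ι
  refine Fintype.linearIndependent_iff.mpr fun α hα => ?_
  let c : S → B := Function.extend j (fun x => α x • u x) 0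
  have c_apply : ∀ x, c (j x) = α x • u x := hj.extend_apply _ _
  have c_eq_zero : ∀ s ∉ Set.range j, c s = 0 := fun s hs => Function.extend_apply' _ _ s hs
  have hc : ∀ s, IsConjugator s (c s) := fun s => by
    by_cases hs : s ∈ Set.range j
    · obtain ⟨x, rfl⟩ := hs
      exact c_apply x ▸ (hu x).smul _
    · intro z
      rw [c_eq_zero s hs, mul_zero, zero_mul]
  have sum_c : ∑ s, c s = 0 := by
    rw [← hα, Fintype.sum_of_injective j hj _ _ c_eq_zero fun x => (c_apply x).symm]
  intro x
  have h := congrFun (hB.eq_zero_of_sum_conjugators hc sum_c) (j x)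
  exact (smul_eq_zero.mp ((c_apply x).symm.trans h)).resolve_right (h0 x)

theorem eq_of_isConjugator (hB : IsGaloisAlgebra k S B) {s t : S} {v : B} (h0 : v ≠ 0)
    (hs : IsConjugator s v) (ht : IsConjugator t v) : s = t := by
  have := hB.nontrivial
  have hli := hB.linearIndependent_conjugators k (j := Subtype.val)
    (ι := {r // IsConjugator r v}) Subtype.val_injective (u := fun _ => v) (fun _ => h0)
    fun r => r.2
  exact congrArg Subtype.val (hli.injective (a₁ := ⟨s, hs⟩) (a₂ := ⟨t, ht⟩) rfl)

theorem eq_one_of_forall_smul_eq (hB : IsGaloisAlgebra k S B) {s : S} (hs : ∀ b : B, s • b = b) :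
    s = 1 := by
  have := hB.nontrivial
  exact hB.eq_of_isConjugator one_ne_zero (fun z => by rw [hs, mul_one, one_mul]) .one

end IsGaloisAlgebra

/-! ### Simple Galois algebras: the center -/

section Center

variable {k K Γ B : Type*} [Field k] [Field K] [Algebra k K] [Ring B] [Algebra k B] [Algebra K B]
  [IsScalarTower k K B] [Algebra.IsCentral K B] [Group Γ] [MulSemiringAction Γ B]
  [SMulCommClass Γ k B]

omit [Algebra k K] [IsScalarTower k K B] [SMulCommClass Γ k B] in
theorem smul_algebraMap_mem_range (s : Γ) (α : K) :
    s • algebraMap K B α ∈ (algebraMap K B).range := by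
  have hcomm (z : B) : z * s • algebraMap K B α = s • algebraMap K B α * z := by
    rw [← smul_inv_smul s z, ← smul_mul', ← smul_mul', Algebra.commutes]
  obtain ⟨β, hβ⟩ := (Algebra.IsCentral.mem_center_iff K).mp (Subalgebra.mem_center_iff.mpr hcomm)
  exact ⟨β, hβ.symm⟩

variable (k K Γ B) [Nontrivial B]

/-- The homomorphism `Γ → Gal(K|k)` by which a group of `k`-algebra automorphisms acts on the
center `K` of `B`. -/
def centerHom : Γ →* (K ≃ₐ[k] K) :=
  let ι := AlgEquiv.ofInjective (IsScalarTower.toAlgHom k K B) (algebraMap K B).injective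
  let restrict (s : Γ) : K →ₐ[k] K := ι.symm.toAlgHom.comp
    (((MulSemiringAction.toAlgHom k B s).comp (IsScalarTower.toAlgHom k K B)).codRestrict
      (IsScalarTower.toAlgHom k K B).range (smul_algebraMap_mem_range s))
  have restrict_apply (s : Γ) (α : K) :
      algebraMap K B (restrict s α) = s • algebraMap K B α :=
    congrArg Subtype.val (ι.apply_symm_apply _)
  (AlgEquiv.algHomUnitsEquiv k K).toMonoidHom.comp <| MonoidHom.toHomUnits
    { toFun := restrict
      map_one' := AlgHom.ext fun α => (algebraMap K B).injective <| by
        rw [restrict_apply, one_smul, AlgHom.one_apply]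
      map_mul' := fun s t => AlgHom.ext fun α => (algebraMap K B).injective <| by
        rw [AlgHom.mul_apply, restrict_apply, restrict_apply, restrict_apply, mul_smul] }

variable {Γ B}

theorem algebraMap_centerHom (s : Γ) (α : K) :
    algebraMap K B (centerHom k K Γ B s α) = s • algebraMap K B α :=
  congrArg Subtype.val (AlgEquiv.apply_symm_apply
    (AlgEquiv.ofInjective (IsScalarTower.toAlgHom k K B) (algebraMap K B).injective) _)

theorem smul_smul_eq_centerHom_smul (s : Γ) (α : K) (b : B) :
    s • α • b = centerHom k K Γ B s α • s • b := by
  rw [Algebra.smul_def, smul_mul', ← algebraMap_centerHom k, ← Algebra.smul_def]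

end Center

namespace IsConjugator

variable {k K S B : Type*} [Field k] [Field K] [Algebra k K] [Ring B] [Algebra k B] [Algebra K B]
  [IsScalarTower k K B] [IsSimpleRing B] [Algebra.IsCentral K B] [Group S]
  [MulSemiringAction S B] [SMulCommClass S k B] {s : S} {u v : B}

theorem centerHom_eq_one (hu : IsConjugator s u) (h0 : u ≠ 0) : centerHom k K S B s = 1 := by
  ext α
  have h := hu (algebraMap K B α)
  rw [← algebraMap_centerHom k, ← Algebra.commutes, ← sub_eq_zero, ← sub_mul, ← map_sub,
    ← Algebra.smul_def, smul_eq_zero] at h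
  exact sub_eq_zero.mp (h.resolve_right h0)

variable (K) in
omit [Algebra k K] [IsScalarTower k K B] [Algebra k B] [SMulCommClass S k B] in
theorem exists_smul_eq [IsDedekindFiniteMonoid B] (hu : IsConjugator s u) (h0 : u ≠ 0)
    (hv : IsConjugator s v) : ∃ α : K, α • u = v := by
  obtain ⟨w, rfl⟩ := hu.isUnit h0
  have smul_eq (z : B) : s • z = ↑w * z * ↑w⁻¹ := by
    rw [← hu z, Units.mul_inv_cancel_right]
  have hcomm (z : B) : z * (↑w⁻¹ * v) = ↑w⁻¹ * v * z := by
    have h := hv z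
    rw [smul_eq] at h
    rw [mul_assoc (↑w⁻¹ : B) v z, ← h]
    simp only [mul_assoc, Units.inv_mul_cancel_left]
  obtain ⟨α, hα⟩ := (Algebra.IsCentral.mem_center_iff K).mp (Subalgebra.mem_center_iff.mpr hcomm)
  exact ⟨α, by rw [Algebra.smul_def, ← hα, ← hcomm, Units.mul_inv_cancel_left]⟩

end IsConjugator

namespace IsGaloisAlgebra

variable {k K S B : Type*} [Field k] [Field K] [Algebra k K] [Ring B] [Algebra k B] [Algebra K B]
  [IsScalarTower k K B] [IsSimpleRing B] [Algebra.IsCentral K B] [Group S] [Finite S]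
  [MulSemiringAction S B] [SMulCommClass S k B]

omit [Algebra.IsCentral K B] in
variable (K) in
theorem finiteDimensional_center (hB : IsGaloisAlgebra k S B) : FiniteDimensional k K :=
  have := hB.finiteDimensional
  .of_injective (IsScalarTower.toAlgHom k K B).toLinearMap (algebraMap K B).injective

theorem centerHom_surjective (hB : IsGaloisAlgebra k S B) :
    Function.Surjective (centerHom k K S B) := by
  have := hB.finiteDimensional_center K
  have hfix : IntermediateField.fixedField (centerHom k K S B).range = ⊥ := eq_bot_iff.mpr
    fun α hα => by
      rw [IntermediateField.mem_fixedField_iff] at hα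
      obtain ⟨c, hc⟩ := (hB.invariants (algebraMap K B α)).mp fun s => by
        rw [← algebraMap_centerHom k, hα _ ⟨s, rfl⟩]
      refine IntermediateField.mem_bot.mpr ⟨c, (algebraMap K B).injective ?_⟩
      rw [← hc, ← IsScalarTower.algebraMap_apply]
  rw [← MonoidHom.range_eq_top,
    ← IntermediateField.fixingSubgroup_fixedField (centerHom k K S B).range, hfix,
    IntermediateField.fixingSubgroup_bot]

theorem card_ker_centerHom_mul (hB : IsGaloisAlgebra k S B) :
    Nat.card (centerHom k K S B).ker * Nat.card (K ≃ₐ[k] K) = Nat.card S := by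
  rw [← (centerHom k K S B).ker.card_mul_index, Subgroup.index_ker,
    MonoidHom.range_eq_top.mpr hB.centerHom_surjective, Subgroup.card_top]

theorem finrank_center_eq_card_ker [IsGalois k K] (hB : IsGaloisAlgebra k S B) :
    Module.finrank K B = Nat.card (centerHom k K S B).ker := by
  have := hB.finiteDimensional_center K
  refine Nat.eq_of_mul_eq_mul_left (Module.finrank_pos (R := k) (M := K)) ?_
  rw [Module.finrank_mul_finrank, hB.finrank_eq_card, ← hB.card_ker_centerHom_mul (K := K),
    IsGalois.card_aut_eq_finrank, mul_comm]

omit [Algebra k K] [IsScalarTower k K B] in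
variable (K) in
theorem span_conjugators (hB : IsGaloisAlgebra k S B) {ι : Type*} {j : ι → S}
    {u : ι → B} (h0 : ∀ x, u x ≠ 0) (hu : ∀ x, IsConjugator (j x) (u x))
    (hj : ∀ (s : S) (v : B), v ≠ 0 → IsConjugator s v → s ∈ Set.range j) :
    Submodule.span K (Set.range u) = ⊤ := by
  cases nonempty_fintype S
  have := hB.isNoetherianRing
  refine eq_top_iff.mpr fun b _ => ?_
  obtain ⟨c, hc, rfl⟩ := hB.exists_sum_conjugators b
  refine Submodule.sum_mem _ fun s _ => ?_
  by_cases hcs : c s = 0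
  · exact hcs ▸ Submodule.zero_mem _
  · obtain ⟨x, rfl⟩ := hj s _ hcs (hc s)
    obtain ⟨α, hα⟩ := (hu x).exists_smul_eq K (h0 x) (hc _)
    exact hα ▸ Submodule.smul_mem _ α (Submodule.subset_span (Set.mem_range_self x))

/-- Skolem–Noether for Galois algebras. -/
theorem exists_conjugator [IsGalois k K] (hB : IsGaloisAlgebra k S B) {s : S}
    (hs : centerHom k K S B s = 1) : ∃ u : B, u ≠ 0 ∧ IsConjugator s u := by
  let T : Set S := {s | ∃ u : B, u ≠ 0 ∧ IsConjugator s u}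
  choose u hu0 hu using fun t : T => t.2
  have hli := hB.linearIndependent_conjugators K Subtype.val_injective hu0 hu
  have hspan := hB.span_conjugators K hu0 hu fun s v hv0 hv => ⟨⟨s, v, hv0, hv⟩, rfl⟩
  have hcard : T.ncard = Nat.card (centerHom k K S B).ker := by
    rw [← hB.finrank_center_eq_card_ker, Module.finrank_eq_nat_card_basis
      (Module.Basis.mk hli hspan.ge), Nat.card_coe_set_eq]
  have hle : T ⊆ (centerHom k K S B).ker := fun t ⟨u, hu0, hu⟩ => hu.centerHom_eq_one hu0
  have heq : T = (centerHom k K S B).ker := Set.eq_of_subset_of_ncard_le hle hcard.ge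
  exact heq.ge hs

end IsGaloisAlgebra

/-! ### Commuting actions and characters -/

theorem card_ker_mul_card_range {G H : Type*} [Group G] [Group H] (f : G →* H) :
    Nat.card f.ker * Nat.card f.range = Nat.card G := by
  rw [← Subgroup.index_ker, Subgroup.card_mul_index]

section Characters

variable {K N ι : Type*} [Field K] [Group N] {χ : ι → N →* K}

theorem linearIndependent_of_injective_monoidHom (hχ : Function.Injective χ) :
    LinearIndependent K fun i => (χ i : N → K) :=
  (linearIndependent_monoidHom N K).comp χ hχ

variable [Finite N]

theorem finite_of_injective_monoidHom (hχ : Function.Injective χ) : Finite ι :=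
  (linearIndependent_of_injective_monoidHom hχ).finite

theorem card_le_of_injective_monoidHom (hχ : Function.Injective χ) :
    Nat.card ι ≤ Nat.card N := by
  cases nonempty_fintype N
  have := finite_of_injective_monoidHom hχ
  cases nonempty_fintype ι
  have h := (linearIndependent_of_injective_monoidHom hχ).fintype_card_le_finrank
  rwa [Module.finrank_pi, ← Nat.card_eq_fintype_card, ← Nat.card_eq_fintype_card] at h

theorem span_eq_top_of_injective_monoidHom (hχ : Function.Injective χ)
    (hcard : Nat.card N ≤ Nat.card ι) :
    Submodule.span K (Set.range fun i => (χ i : N → K)) = ⊤ := by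
  cases nonempty_fintype N
  have := finite_of_injective_monoidHom hχ
  cases nonempty_fintype ι
  refine (linearIndependent_of_injective_monoidHom hχ).span_eq_top_of_card_eq_finrank' ?_
  rw [Module.finrank_pi, ← Nat.card_eq_fintype_card, ← Nat.card_eq_fintype_card]
  exact (card_le_of_injective_monoidHom hχ).antisymm hcard

theorem eq_of_forall_character_eq (hχ : Function.Injective χ) (hcard : Nat.card N ≤ Nat.card ι)
    {x y : N} (hxy : ∀ i, χ i x = χ i y) : x = y := by
  classical
  let difference : (N → K) →ₗ[K] K :=
    LinearMap.proj (R := K) (φ := fun _ : N => K) x - LinearMap.proj y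
  have hzero : difference = 0 := LinearMap.ext_on_range
    (span_eq_top_of_injective_monoidHom hχ hcard) fun i => sub_eq_zero.mpr (hxy i)
  by_contra hne
  have h := LinearMap.congr_fun hzero (Pi.single x 1)
  rw [LinearMap.sub_apply, LinearMap.proj_apply, LinearMap.proj_apply, Pi.single_eq_same,
    Pi.single_eq_of_ne' hne, sub_zero] at h
  exact one_ne_zero h

end Characters

/-- For a homomorphism `f : S → Gal(K|k)`, the characters of `ker f` with values in `K` that are
`S`-equivariant for conjugation on `ker f`. They describe the automorphisms of a central simple
Galois algebra over `K` that commute with `S` and fix `K`. -/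
def IsEquivariantCharacter {k K S : Type*} [Field k] [Field K] [Algebra k K] [Group S]
    (f : S →* (K ≃ₐ[k] K)) (χ : f.ker →* K) : Prop :=
  ∀ (g : S) (x : f.ker), χ (MulAut.conjNormal g x) = f g (χ x)

section Eigenvalues

variable {k K Γ B : Type*} [Field k] [Field K] [Algebra k K] [Ring B] [Nontrivial B] [Algebra k B]
  [Algebra K B] [IsScalarTower k K B] [Algebra.IsCentral K B] [Group Γ] [MulSemiringAction Γ B]
  [SMulCommClass Γ k B]

variable (k) in
theorem mul_smul_eq_of_smul_eq {s t : Γ} {α β : K} {u : B} (hs : s • u = α • u)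
    (ht : t • u = β • u) : (s * t) • u = (centerHom k K Γ B s β * α) • u := by
  rw [mul_smul, ht, smul_smul_eq_centerHom_smul k, hs, smul_smul]

theorem pow_eq_one_of_smul_eq {s : Γ} (hs : centerHom k K Γ B s = 1) {α : K} {u : B}
    (h0 : u ≠ 0) (h : s • u = α • u) {n : ℕ} (hn : s ^ n = 1) : α ^ n = 1 := by
  have pow_smul (m : ℕ) : s ^ m • u = α ^ m • u := by
    induction m with
    | zero => rw [pow_zero, pow_zero, one_smul, one_smul]
    | succ m ih =>
      rw [pow_succ', mul_smul_eq_of_smul_eq k h ih, hs, AlgEquiv.one_apply, pow_succ]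
  refine smul_left_injective K h0 (?_ : α ^ n • u = (1 : K) • u)
  rw [← pow_smul, hn, one_smul, one_smul]

end Eigenvalues

namespace IsGaloisAlgebra

variable {k K S Γ B : Type*} [Field k] [Field K] [Algebra k K] [IsGalois k K] [Ring B]
  [Algebra k B] [Algebra K B] [IsScalarTower k K B] [IsSimpleRing B] [Algebra.IsCentral K B]
  [Group S] [Finite S] [MulSemiringAction S B] [SMulCommClass S k B] [Group Γ]
  [MulSemiringAction Γ B] [SMulCommClass Γ k B] [SMulCommClass Γ S B]

theorem exists_forall_conjugator_smul_eq (hB : IsGaloisAlgebra k S B) {φ : Γ}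
    (hφ : centerHom k K Γ B φ = 1) {s : S} (hs : centerHom k K S B s = 1) :
    ∃ α : K, ∀ v : B, IsConjugator s v → φ • v = α • v := by
  have := hB.isNoetherianRing
  obtain ⟨u, hu0, hu⟩ := hB.exists_conjugator hs
  have hφu : IsConjugator s (φ • u) :=
    hu.map (MulSemiringAction.toRingEquiv Γ B φ) fun b => smul_comm φ s b
  obtain ⟨α, hα⟩ := hu.exists_smul_eq K hu0 hφu
  refine ⟨α, fun v hv => ?_⟩
  obtain ⟨β, rfl⟩ := hu.exists_smul_eq K hu0 hv
  rw [smul_smul_eq_centerHom_smul k, hφ, AlgEquiv.one_apply, ← hα, smul_comm]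

theorem exists_character (hB : IsGaloisAlgebra k S B) {φ : Γ} (hφ : centerHom k K Γ B φ = 1) :
    ∃ χ : (centerHom k K S B).ker →* K, IsEquivariantCharacter (centerHom k K S B) χ ∧
      ∀ (x : (centerHom k K S B).ker) (v : B), IsConjugator x.1 v → φ • v = χ x • v := by
  have := hB.isNoetherianRing
  choose u hu0 hu using fun x : (centerHom k K S B).ker => hB.exists_conjugator x.2
  choose χ hχ using fun x : (centerHom k K S B).ker => hB.exists_forall_conjugator_smul_eq hφ x.2
  have apply_eq {x : (centerHom k K S B).ker} {v : B} (hv : IsConjugator x.1 v) (h0 : v ≠ 0)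
      {α : K} (h : φ • v = α • v) : χ x = α :=
    smul_left_injective K h0 ((hχ x v hv).symm.trans h)
  refine ⟨⟨⟨χ, apply_eq (x := 1) .one one_ne_zero (by rw [smul_one, one_smul])⟩, fun x y => ?_⟩,
    fun g x => ?_, hχ⟩
  · refine apply_eq (x := x * y) ((hu x).mul (hu y))
      (((hu x).isUnit (hu0 x)).mul ((hu y).isUnit (hu0 y))).ne_zero ?_
    rw [smul_mul', hχ x _ (hu x), hχ y _ (hu y), smul_mul_smul_comm]
  · refine apply_eq (x := MulAut.conjNormal g x) ((hu x).act g)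
      ((smul_ne_zero_iff_ne g).mpr (hu0 x)) ?_
    rw [smul_comm, hχ x _ (hu x), smul_smul_eq_centerHom_smul k]
    rfl

theorem exists_injective_character [FaithfulSMul Γ B] (hB : IsGaloisAlgebra k S B) :
    ∃ χ : (centerHom k K Γ B).ker → (centerHom k K S B).ker →* K,
      Function.Injective χ ∧ ∀ φ, IsEquivariantCharacter (centerHom k K S B) (χ φ) := by
  cases nonempty_fintype S
  choose χ hχ hsmul using fun φ : (centerHom k K Γ B).ker => hB.exists_character φ.2
  refine ⟨χ, fun φ φ' h => Subtype.ext (eq_of_smul_eq_smul fun b : B => ?_), hχ⟩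
  obtain ⟨c, hc, rfl⟩ := hB.exists_sum_conjugators b
  rw [Finset.smul_sum, Finset.smul_sum]
  refine Finset.sum_congr rfl fun s _ => ?_
  by_cases h0 : c s = 0
  · rw [h0, smul_zero, smul_zero]
  · have hs : s ∈ (centerHom k K S B).ker := (hc s).centerHom_eq_one h0
    rw [hsmul φ ⟨s, hs⟩ _ (hc s), hsmul φ' ⟨s, hs⟩ _ (hc s), h]

section Card

variable [FaithfulSMul Γ B]

variable (K) in
theorem card_ker_centerHom_le (hB : IsGaloisAlgebra k S B) :
    Nat.card (centerHom k K Γ B).ker ≤ Nat.card (centerHom k K S B).ker := by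
  obtain ⟨χ, hχ, -⟩ := hB.exists_injective_character (K := K) (Γ := Γ)
  exact card_le_of_injective_monoidHom hχ

variable (K Γ) in
include K in
theorem finite_of_faithfulSMul (hB : IsGaloisAlgebra k S B) : Finite Γ := by
  have := hB.finiteDimensional_center K
  obtain ⟨χ, hχ, -⟩ := hB.exists_injective_character (K := K) (Γ := Γ)
  have := finite_of_injective_monoidHom hχ
  refine Nat.finite_of_card_ne_zero ?_
  rw [← card_ker_mul_card_range (centerHom k K Γ B)]
  exact mul_ne_zero Nat.card_pos.ne' Nat.card_pos.ne'

variable (K Γ) in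
include K in
theorem card_le_card (hB : IsGaloisAlgebra k S B) : Nat.card Γ ≤ Nat.card S := by
  have := hB.finiteDimensional_center K
  calc
    Nat.card Γ = Nat.card (centerHom k K Γ B).ker * Nat.card (centerHom k K Γ B).range :=
      (card_ker_mul_card_range _).symm
    _ ≤ Nat.card (centerHom k K S B).ker * Nat.card (K ≃ₐ[k] K) :=
      Nat.mul_le_mul (hB.card_ker_centerHom_le K) (Subgroup.card_le_card_group _)
    _ = Nat.card S := hB.card_ker_centerHom_mul

variable (Γ) in
theorem eq_of_forall_isEquivariantCharacter_eq (hB : IsGaloisAlgebra k S B)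
    (hcard : Nat.card S ≤ Nat.card Γ) {x y : (centerHom k K S B).ker}
    (h : ∀ χ, IsEquivariantCharacter (centerHom k K S B) χ → χ x = χ y) : x = y := by
  have := hB.finiteDimensional_center K
  obtain ⟨χ, hχ, hχe⟩ := hB.exists_injective_character (K := K) (Γ := Γ)
  refine eq_of_forall_character_eq hχ ?_ fun φ => h _ (hχe φ)
  refine Nat.le_of_mul_le_mul_right ?_ (Nat.card_pos (α := K ≃ₐ[k] K))
  calc
    Nat.card (centerHom k K S B).ker * Nat.card (K ≃ₐ[k] K) = Nat.card S :=
      hB.card_ker_centerHom_mul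
    _ ≤ Nat.card Γ := hcard
    _ = Nat.card (centerHom k K Γ B).ker * Nat.card (centerHom k K Γ B).range :=
      (card_ker_mul_card_range _).symm
    _ ≤ Nat.card (centerHom k K Γ B).ker * Nat.card (K ≃ₐ[k] K) :=
      Nat.mul_le_mul_left _ (Subgroup.card_le_card_group _)

variable (Γ) in
theorem mul_comm_of_centerHom_eq_one (hB : IsGaloisAlgebra k S B)
    (hcard : Nat.card S ≤ Nat.card Γ) {x y : S} (hx : centerHom k K S B x = 1)
    (hy : centerHom k K S B y = 1) : x * y = y * x :=
  congrArg Subtype.val (hB.eq_of_forall_isEquivariantCharacter_eq (K := K) Γ hcard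
    (x := ⟨x, hx⟩ * ⟨y, hy⟩) (y := ⟨y, hy⟩ * ⟨x, hx⟩) fun χ _ => by
      rw [map_mul, map_mul, mul_comm])

variable (K Γ) in
theorem centerHom_surjective_of_card_le (hB : IsGaloisAlgebra k S B)
    (hcard : Nat.card S ≤ Nat.card Γ) : Function.Surjective (centerHom k K Γ B) := by
  have := hB.finiteDimensional_center K
  refine MonoidHom.range_eq_top.mp (Subgroup.eq_top_of_le_card _ ?_)
  refine Nat.le_of_mul_le_mul_left ?_ (Nat.card_pos (α := (centerHom k K S B).ker))
  calc
    Nat.card (centerHom k K S B).ker * Nat.card (K ≃ₐ[k] K) = Nat.card S :=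
      hB.card_ker_centerHom_mul
    _ ≤ Nat.card Γ := hcard
    _ = Nat.card (centerHom k K Γ B).ker * Nat.card (centerHom k K Γ B).range :=
      (card_ker_mul_card_range _).symm
    _ ≤ Nat.card (centerHom k K S B).ker * Nat.card (centerHom k K Γ B).range :=
      Nat.mul_le_mul_right _ (hB.card_ker_centerHom_le K)

end Card

end IsGaloisAlgebra

/-! ### Systems of conjugators and their cocycles -/

theorem IsGaloisAlgebra.eq_of_smul_conjugator_eq {k S B : Type*} [Field k] [Group S] [Finite S]
    [Ring B] [Algebra k B] [MulSemiringAction S B] [SMulCommClass S k B]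
    (hB : IsGaloisAlgebra k S B) {s t : S}
    (hst : ∀ (y : S) (u : B), u ≠ 0 → IsConjugator y u → s • u = t • u) : s = t := by
  cases nonempty_fintype S
  refine eq_of_inv_mul_eq_one (hB.eq_one_of_forall_smul_eq fun b => ?_)
  obtain ⟨c, hc, rfl⟩ := hB.exists_sum_conjugators b
  rw [mul_smul, inv_smul_eq_iff, Finset.smul_sum, Finset.smul_sum]
  refine Finset.sum_congr rfl fun y _ => ?_
  by_cases h0 : c y = 0
  · rw [h0, smul_zero, smul_zero]
  · exact (hst y _ h0 (hc y)).symm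

/-- A choice of nonzero conjugators `u_x ∈ B` for the automorphisms `j x`, `x ∈ N`, normalized by
`u_1 = 1`. When the `u_x` span a twisted group algebra, they are its canonical basis. -/
structure ConjugatorSystem {N S : Type*} [Group N] [Group S] (j : N →* S) (B : Type*) [Ring B]
    [MulSemiringAction S B] where
  toFun : N → B
  map_one : toFun 1 = 1
  ne_zero : ∀ x, toFun x ≠ 0
  isConjugator : ∀ x, IsConjugator (j x) (toFun x)

namespace ConjugatorSystem

variable {K N S B : Type*} [Field K] [Group N] [Group S] [Ring B] [Algebra K B]
  [MulSemiringAction S B] {j : N →* S}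

instance : CoeFun (ConjugatorSystem j B) (fun _ => N → B) := ⟨toFun⟩

variable (u : ConjugatorSystem j B)

theorem eq_of_smul_eq {x : N} {α β : Kˣ} (h : (α : K) • u x = (β : K) • u x) : α = β :=
  Units.ext (smul_left_injective K (u.ne_zero x) h)

/-- The conjugators of a system, reindexed along a homomorphism. -/
def comp {N' : Type*} [Group N'] (c : N' →* N) : ConjugatorSystem (j.comp c) B where
  toFun x := u (c x)
  map_one := by rw [_root_.map_one, u.map_one]
  ne_zero x := u.ne_zero (c x)
  isConjugator x := u.isConjugator (c x)

/-- The image of a system of conjugators under an automorphism of `B`. -/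
def map {j' : N →* S} (ψ : B ≃+* B) (hψ : ∀ x b, ψ (j x • b) = j' x • ψ b) :
    ConjugatorSystem j' B where
  toFun x := ψ (u x)
  map_one := by rw [u.map_one, _root_.map_one]
  ne_zero x := (map_ne_zero_iff ψ ψ.injective).mpr (u.ne_zero x)
  isConjugator x := (u.isConjugator x).map ψ (hψ x)

theorem isConjugator_mul (x y : N) : IsConjugator (j (x * y)) (u x * u y) := by
  rw [map_mul]
  exact (u.isConjugator x).mul (u.isConjugator y)

variable [IsSimpleRing B] [IsDedekindFiniteMonoid B]

theorem isUnit (x : N) : IsUnit (u x) := (u.isConjugator x).isUnit (u.ne_zero x)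

variable [Algebra.IsCentral K B]

variable (K) in
theorem exists_unit_smul_eq {x : N} {v : B} (hv : IsConjugator (j x) v) (h0 : v ≠ 0) :
    ∃ α : Kˣ, (α : K) • u x = v := by
  obtain ⟨α, rfl⟩ := (u.isConjugator x).exists_smul_eq K (u.ne_zero x) hv
  exact ⟨Units.mk0 α (left_ne_zero_of_smul h0), rfl⟩

variable (K) in
/-- The factor set of a system of conjugators: the scalar `σ(x, y)` with
`u_x u_y = σ(x, y) u_{xy}`. It is a 2-cocycle, see `ConjugatorSystem.twoCocycle`. -/
def factorSet (x y : N) : Kˣ :=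
  (u.exists_unit_smul_eq K (u.isConjugator_mul x y) ((u.isUnit x).mul (u.isUnit y)).ne_zero).choose

theorem factorSet_smul (x y : N) : (u.factorSet K x y : K) • u (x * y) = u x * u y :=
  (u.exists_unit_smul_eq K (u.isConjugator_mul x y)
    ((u.isUnit x).mul (u.isUnit y)).ne_zero).choose_spec

variable (K) in
/-- The 2-cocycle `σ` with `u_x u_y = σ(x, y) u_{xy}`. -/
def twoCocycle : TwoCocycle N Kˣ where
  toFun := u.factorSet K
  one_left x := by
    apply u.eq_of_smul_eq (x := x)
    rw [Units.val_one, one_smul]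
    simpa only [u.map_one, one_mul] using u.factorSet_smul (K := K) 1 x
  one_right x := by
    apply u.eq_of_smul_eq (x := x)
    rw [Units.val_one, one_smul]
    simpa only [u.map_one, mul_one] using u.factorSet_smul (K := K) x 1
  cocycle x y z := by
    apply u.eq_of_smul_eq (x := x * y * z)
    rw [Units.val_mul, Units.val_mul, ← smul_smul, ← smul_smul, u.factorSet_smul, mul_assoc x y z,
      u.factorSet_smul, ← smul_mul_assoc, ← mul_smul_comm, u.factorSet_smul, u.factorSet_smul,
      mul_assoc]

variable (K) in
theorem mul_eq (x y : N) : u x * u y = (u.twoCocycle K x y : K) • u (x * y) :=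
  (u.factorSet_smul x y).symm

variable (K) in
theorem mul_eq_alt_smul_mul {x y : N} (hxy : x * y = y * x) :
    u x * u y = ((u.twoCocycle K).alt x y : K) • (u y * u x) := by
  rw [u.mul_eq K, u.mul_eq K, smul_smul, ← Units.val_mul, TwoCocycle.alt,
    div_mul_cancel, hxy]

variable (K) in
theorem smul_eq_alt {x y : N} (hxy : x * y = y * x) :
    j x • u y = ((u.twoCocycle K).alt x y : K) • u y := by
  refine (u.isUnit x).mul_left_injective ?_
  change j x • u y * u x = (_ • u y) * u x
  rw [u.isConjugator x, u.mul_eq_alt_smul_mul K hxy, smul_mul_assoc]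

theorem isNondegenerate {k : Type*} [Field k] [Algebra k K] [Algebra k B]
    [IsScalarTower k K B] [SMulCommClass S k B] [Finite S]
    (hB : IsGaloisAlgebra k S B) (hj : Function.Injective j) (hN : ∀ x y : N, x * y = y * x)
    (hr : ∀ (s : S) (v : B), v ≠ 0 → IsConjugator s v → s ∈ Set.range j) :
    (u.twoCocycle K).IsNondegenerate := fun x hx => by
  refine hj ((hB.eq_of_smul_conjugator_eq fun s v h0 hv => ?_).trans (_root_.map_one j).symm)
  obtain ⟨y, rfl⟩ := hr s v h0 hv
  obtain ⟨α, rfl⟩ := u.exists_unit_smul_eq K hv h0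
  rw [one_smul, smul_smul_eq_centerHom_smul k,
    (u.isConjugator x).centerHom_eq_one (u.ne_zero x), AlgEquiv.one_apply,
    u.smul_eq_alt K (hN x y), TwoCocycle.alt, hx y (hN x y), div_self',
    Units.val_one, one_smul]

theorem twoCocycle_comp {N' : Type*} [Group N'] (c : N' →* N) (x y : N') :
    (u.comp c).twoCocycle K x y = u.twoCocycle K (c x) (c y) := by
  apply (u.comp c).eq_of_smul_eq (x := x * y)
  rw [← mul_eq]
  exact (u.mul_eq K (c x) (c y)).trans (by rw [← _root_.map_mul c]; rfl)

theorem twoCocycle_map {j' : N →* S} (ψ : B ≃ₐ[K] B) (hψ : ∀ x b, ψ (j x • b) = j' x • ψ b)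
    (x y : N) : (u.map ψ.toRingEquiv hψ).twoCocycle K x y = u.twoCocycle K x y := by
  apply (u.map ψ.toRingEquiv hψ).eq_of_smul_eq (x := x * y)
  rw [← mul_eq]
  change ψ (u x) * ψ (u y) = _ • ψ (u (x * y))
  rw [← _root_.map_mul, u.mul_eq K, map_smul]

theorem exists_coboundary (u v : ConjugatorSystem j B) :
    ∃ η : N → Kˣ, (∀ x, (η x : K) • u x = v x) ∧ η 1 = 1 ∧
      ∀ x y, v.twoCocycle K x y = u.twoCocycle K x y * (η y * η x / η (x * y)) := by
  choose η hη using fun x => u.exists_unit_smul_eq K (v.isConjugator x) (v.ne_zero x)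
  refine ⟨η, hη, ?_, fun x y => ?_⟩
  · apply u.eq_of_smul_eq (x := 1)
    rw [hη, v.map_one, u.map_one, Units.val_one, one_smul]
  · have h : η x * η y * u.twoCocycle K x y = v.twoCocycle K x y * η (x * y) := by
      apply u.eq_of_smul_eq (x := x * y)
      simp only [Units.val_mul]
      rw [← smul_smul, ← u.mul_eq K, ← smul_mul_smul_comm, ← smul_smul, hη, hη, hη, v.mul_eq K]
    rw [← mul_div_assoc, eq_div_iff_mul_eq', ← h, mul_comm (η x), mul_comm]

section Center

variable {k : Type*} [Field k] [Algebra k K] [Algebra k B] [IsScalarTower k K B]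
  [SMulCommClass S k B]

variable (k) in
include k in
theorem alt_pow_eq_one {x y : N} (hxy : x * y = y * x) {n : ℕ} (hx : x ^ n = 1) :
    (u.twoCocycle K).alt x y ^ n = 1 := by
  refine Units.ext ?_
  rw [Units.val_pow_eq_pow_val, Units.val_one]
  exact pow_eq_one_of_smul_eq ((u.isConjugator x).centerHom_eq_one (k := k) (u.ne_zero x))
    (u.ne_zero y) (u.smul_eq_alt K hxy) (by rw [← map_pow, hx, _root_.map_one])

section Eigenvalue

variable (hc : ∀ s x, s * j x = j x * s)

include hc in
omit [IsSimpleRing B] [IsDedekindFiniteMonoid B] in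
theorem isConjugator_smul (s : S) (x : N) : IsConjugator (j x) (s • u x) := by
  simpa only [hc s x, mul_inv_cancel_right] using (u.isConjugator x).act s

variable (K) in
/-- If `S` commutes with the `j x`, the scalar `γ(s, x)` with `s • u_x = γ(s, x) u_x`. -/
def eigenvalue (s : S) (x : N) : Kˣ :=
  (u.exists_unit_smul_eq K (u.isConjugator_smul hc s x)
    ((smul_ne_zero_iff_ne s).mpr (u.ne_zero x))).choose

theorem eigenvalue_smul (s : S) (x : N) : (u.eigenvalue K hc s x : K) • u x = s • u x :=
  (u.exists_unit_smul_eq K (u.isConjugator_smul hc s x)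
    ((smul_ne_zero_iff_ne s).mpr (u.ne_zero x))).choose_spec

theorem eigenvalue_eq_of_smul_eq {s : S} {x : N} {α : Kˣ} (h : s • u x = (α : K) • u x) :
    u.eigenvalue K hc s x = α :=
  u.eq_of_smul_eq ((u.eigenvalue_smul hc s x).trans h)

theorem eigenvalue_eq_one {s : S} {x : N} (h : s • u x = u x) : u.eigenvalue K hc s x = 1 :=
  u.eigenvalue_eq_of_smul_eq hc (h.trans (one_smul K (u x)).symm)

theorem eigenvalue_one_left (x : N) : u.eigenvalue K hc 1 x = 1 :=
  u.eigenvalue_eq_one hc (one_smul S _)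

theorem eigenvalue_one_right (s : S) : u.eigenvalue K hc s 1 = 1 :=
  u.eigenvalue_eq_one hc (by rw [u.map_one, smul_one])

theorem eigenvalue_eq_alt {x y : N} (hxy : x * y = y * x) :
    u.eigenvalue K hc (j x) y = (u.twoCocycle K).alt x y :=
  u.eigenvalue_eq_of_smul_eq hc (u.smul_eq_alt K hxy)

theorem eigenvalue_mul_left (s t : S) (x : N) :
    (u.eigenvalue K hc (s * t) x : K) =
      centerHom k K S B s (u.eigenvalue K hc t x : K) * u.eigenvalue K hc s x := by
  refine smul_left_injective K (u.ne_zero x) ((u.eigenvalue_smul hc (s * t) x).trans ?_)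
  exact mul_smul_eq_of_smul_eq k (u.eigenvalue_smul hc s x).symm (u.eigenvalue_smul hc t x).symm

theorem eigenvalue_mul_right (s : S) (x y : N) :
    centerHom k K S B s (u.twoCocycle K x y : K) * u.eigenvalue K hc s (x * y) =
      u.twoCocycle K x y * u.eigenvalue K hc s x * u.eigenvalue K hc s y := by
  refine smul_left_injective K (u.ne_zero (x * y)) (?_ : _ • u (x * y) = _ • u (x * y))
  calc
    _ = s • (u x * u y) := by
      rw [← smul_smul, u.eigenvalue_smul, ← smul_smul_eq_centerHom_smul, ← u.mul_eq K]
    _ = _ := by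
      rw [smul_mul', ← u.eigenvalue_smul (K := K) hc, ← u.eigenvalue_smul (K := K) hc,
        smul_mul_smul_comm, u.mul_eq K, smul_smul]
      congr 1
      ring

theorem eigenvalue_comp {N' : Type*} [Group N'] (c : N' →* N) (s : S) (x : N') :
    (u.comp c).eigenvalue K (fun s x => hc s (c x)) s x = u.eigenvalue K hc s (c x) :=
  (u.comp c).eigenvalue_eq_of_smul_eq _ (u.eigenvalue_smul hc s (c x)).symm

theorem eigenvalue_map {j' : N →* S} (hc' : ∀ s x, s * j' x = j' x * s) (ψ : B ≃ₐ[K] B)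
    (hψ : ∀ x b, ψ (j x • b) = j' x • ψ b) {s t : S} (hst : ∀ b, ψ (s • b) = t • ψ b) (x : N) :
    (u.map ψ.toRingEquiv hψ).eigenvalue K hc' t x = u.eigenvalue K hc s x := by
  refine (u.map ψ.toRingEquiv hψ).eigenvalue_eq_of_smul_eq hc' ?_
  change t • ψ (u x) = _ • ψ (u x)
  rw [← hst, ← u.eigenvalue_smul (K := K) hc, map_smul]

theorem eigenvalue_eq_mul_div (u v : ConjugatorSystem j B) {η : N → Kˣ}
    (hη : ∀ x, (η x : K) • u x = v x) (s : S) (x : N) :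
    (v.eigenvalue K hc s x : K) =
      u.eigenvalue K hc s x * (centerHom k K S B s (η x : K) / η x) := by
  rw [mul_div_assoc', eq_div_iff (η x).ne_zero]
  refine smul_left_injective K (u.ne_zero x) (?_ : _ • u x = _ • u x)
  rw [← smul_smul, hη, v.eigenvalue_smul, ← hη, smul_smul_eq_centerHom_smul k,
    ← u.eigenvalue_smul (K := K) hc, smul_smul, mul_comm]

end Eigenvalue

end Center

section PowFour

omit [IsSimpleRing B] [IsDedekindFiniteMonoid B] [Algebra.IsCentral K B] [MulSemiringAction S B]
  [Group N] [Group S]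

theorem mul_pow_four_eq_one {v w : B} {α : K} (hα : α ^ 2 = 1) (hvw : v * w = α • (w * v))
    (hv : v ^ 4 = 1) (hw : w ^ 4 = 1) : (v * w) ^ 4 = 1 := by
  have hwv : w * v = α • (v * w) := by rw [hvw, smul_smul, ← sq, hα, one_smul]
  have hcomm : Commute (v ^ 2) (w ^ 2) := by
    refine Commute.pow_right ?_ 2
    change v ^ 2 * w = w * v ^ 2
    rw [sq, mul_assoc, hvw, mul_smul_comm, ← mul_assoc, hvw, smul_mul_assoc, smul_smul, ← sq, hα,
      one_smul, mul_assoc]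
  have hsq : (v * w) ^ 2 = α • (v ^ 2 * w ^ 2) := by
    rw [sq, mul_assoc, ← mul_assoc w, hwv, smul_mul_assoc, mul_smul_comm, sq, sq]
    simp only [mul_assoc]
  calc
    (v * w) ^ 4 = ((v * w) ^ 2) ^ 2 := by rw [← pow_mul]
    _ = (v ^ 2) ^ 2 * (w ^ 2) ^ 2 := by rw [hsq, smul_pow, hα, one_smul, hcomm.mul_pow]
    _ = 1 := by rw [← pow_mul, ← pow_mul, hv, hw, one_mul]

theorem pow_eq_one_of_smul_pow_eq_one [Nontrivial B] {v : B} {α : K} {n : ℕ} (hv : v ^ n = 1)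
    (h : (α • v) ^ n = 1) : α ^ n = 1 := by
  rw [smul_pow, hv] at h
  exact smul_left_injective K (one_ne_zero' B) (h.trans (one_smul K 1).symm)

end PowFour

theorem twoCocycle_pow_four_eq_one (hu : ∀ x, u x ^ 4 = 1) {x y : N} (hxy : x * y = y * x)
    (halt : (u.twoCocycle K).alt x y ^ 2 = 1) : (u.twoCocycle K x y : K) ^ 4 = 1 := by
  refine pow_eq_one_of_smul_pow_eq_one (hu (x * y)) ?_
  rw [← u.mul_eq K]
  have halt' : ((u.twoCocycle K).alt x y : K) ^ 2 = 1 := by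
    rw [← Units.val_pow_eq_pow_val, halt, Units.val_one]
  exact mul_pow_four_eq_one halt' (u.mul_eq_alt_smul_mul K hxy) (hu x) (hu y)

end ConjugatorSystem

/-! ### Recognition of twisted group algebras -/

section GAlgIsomorphic

variable {k G A B C : Type*} [Field k] [Group G] [Ring A] [Algebra k A] [MulSemiringAction G A]
  [Ring B] [Algebra k B] [MulSemiringAction G B] [Ring C] [Algebra k C] [MulSemiringAction G C]

theorem GAlgIsomorphic.trans (h : GAlgIsomorphic k G A B) (h' : GAlgIsomorphic k G B C) :
    GAlgIsomorphic k G A C := by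
  obtain ⟨e, he⟩ := h
  obtain ⟨e', he'⟩ := h'
  exact ⟨e.trans e', fun g a => by rw [AlgEquiv.trans_apply, he, he', AlgEquiv.trans_apply]⟩

theorem GAlgIsomorphic.symm (h : GAlgIsomorphic k G A B) : GAlgIsomorphic k G B A := by
  obtain ⟨e, he⟩ := h
  exact ⟨e.symm, fun g b => e.injective (by rw [he, e.apply_symm_apply, e.apply_symm_apply])⟩

theorem GAlgIsomorphic.induced {S : Subgroup G} {B C : Type*} [Ring B] [Algebra k B]
    [MulSemiringAction S B] [SMulCommClass S k B] [Ring C] [Algebra k C] [MulSemiringAction S C]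
    [SMulCommClass S k C] (h : GAlgIsomorphic k S B C) :
    GAlgIsomorphic k G (inducedAlgebra k S B) (inducedAlgebra k S C) := by
  obtain ⟨e, he⟩ := h
  have he' : ∀ (s : S) (c : C), e.symm (s • c) = s • e.symm c := fun s c => e.injective (by
    rw [he, e.apply_symm_apply, e.apply_symm_apply])
  exact ⟨
    { toFun r := ⟨fun g => e (r.1 g), fun s g => by rw [← he, ← r.2]⟩
      invFun r := ⟨fun g => e.symm (r.1 g), fun s g => by rw [← he', ← r.2]⟩
      left_inv _ := Subtype.ext (funext fun _ => e.symm_apply_apply _)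
      right_inv _ := Subtype.ext (funext fun _ => e.apply_symm_apply _)
      map_mul' _ _ := Subtype.ext (funext fun _ => map_mul e _ _)
      map_add' _ _ := Subtype.ext (funext fun _ => map_add e _ _)
      commutes' c := Subtype.ext (funext fun _ => e.commutes c) }, fun _ _ => rfl⟩

end GAlgIsomorphic

section GaloisDatum

variable {k K G B : Type*} [Field k] [Field K] [Algebra k K] [Group G] [Ring B] [Algebra k B]
  [Algebra K B] [IsScalarTower k K B]

theorem GaloisDatum.isomorphic_alg (D : GaloisDatum k K G) [MulSemiringAction D.S B]
    (b : Module.Basis D.N K B) (hone : b 1 = 1)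
    (hmul : ∀ x y, b x * b y = (D.σ x y : K) • b (x * y))
    (hact : ∀ (g : D.S) (α : K) (x : D.N),
      g • α • b x = (D.toGal g α * D.γ g x) • b (D.conjS g x)) :
    GAlgIsomorphic k D.S D.Alg B := by
  let e : D.Alg ≃+ B := b.repr.symm.toAddEquiv
  have he : ∀ x α, e (D.single x α) = α • b x := fun x α => b.repr_symm_single x α
  have he_mul : ∀ a a', e (a * a') = e a * e a' := fun a a' => by
    induction a using Alg.induction with
    | zero => simp
    | add a₁ a₂ h₁ h₂ => simp only [map_add, add_mul, h₁, h₂]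
    | single x α =>
      induction a' using Alg.induction with
      | zero => simp
      | add a₁ a₂ h₁ h₂ => simp only [map_add, mul_add, h₁, h₂]
      | single y β => rw [D.single_mul_single, he, he, he, smul_mul_smul_comm, hmul, smul_smul]
  have he_smul : ∀ (r : k) a, e (r • a) = r • e a := fun r a => by
    induction a using Alg.induction with
    | zero => simp
    | add a₁ a₂ h₁ h₂ => simp only [map_add, smul_add, h₁, h₂]
    | single x α => rw [D.smul_single, he, he, smul_assoc]
  have he_act : ∀ (g : D.S) a, e (D.act g a) = g • e a := fun g a => by
    induction a using Alg.induction with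
    | zero => simp
    | add a₁ a₂ h₁ h₂ => simp only [map_add, smul_add, h₁, h₂]
    | single x α => rw [D.act_single, he, he, hact]
  have he_one : e 1 = 1 := (he 1 1).trans (by rw [one_smul, hone])
  exact ⟨AlgEquiv.ofLinearEquiv { e with map_smul' := he_smul } he_one he_mul, he_act⟩

theorem RealTorsorDatum.isomorphic_ind {k G B : Type*} [Field k] [IsSemireal k] [Group G]
    [Finite G] [Ring B] [Algebra k B] (D : RealTorsorDatum k G) [MulSemiringAction D.N B]
    [SMulCommClass D.N k B] (b : Module.Basis D.N k B) (hone : b 1 = 1)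
    (hmul : ∀ x y, b x * b y = (D.σ x y : k) • b (x * y))
    (hact : ∀ g x : D.N, g • b x = (D.σ.alt g x : k) • b x) :
    GAlgIsomorphic k G (inducedAlgebra k D.N B) D.toGaloisDatum.Ind := by
  have hcomm : ∀ x y : D.N, x * y = y * x := fun x y =>
    Subtype.ext (D.elementary.comm x x.2 y y.2)
  let : MulSemiringAction D.toGaloisDatum.S B := ‹MulSemiringAction D.N B›
  have : SMulCommClass D.toGaloisDatum.S k B := ‹SMulCommClass D.N k B›
  refine (D.toGaloisDatum.isomorphic_alg b hone hmul fun g α x => ?_).symm.induced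
  have hconj : D.toGaloisDatum.conjS g x = x := Subtype.ext (by
    change (g : G) * x * (g : G)⁻¹ = x
    rw [D.elementary.comm g g.2 x x.2, mul_inv_cancel_right])
  have hγ : D.toGaloisDatum.γ g x = D.σ.alt g x := D.σ.inner_eq_alt hcomm g x
  rw [hconj, smul_comm, mul_smul, hγ]
  exact congrArg (α • ·) (hact g x)

end GaloisDatum

namespace ConjugatorSystem

variable {k K N S B : Type*} [Field k] [Field K] [Group N] [Group S] [Finite S] [Ring B]
  [Algebra k B] [Algebra K B] [IsSimpleRing B] [Algebra.IsCentral K B] [MulSemiringAction S B]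
  [SMulCommClass S k B] {j : N →* S} (u : ConjugatorSystem j B) (hB : IsGaloisAlgebra k S B)
  (hj : Function.Injective j)
  (hr : ∀ (s : S) (v : B), v ≠ 0 → IsConjugator s v → s ∈ Set.range j)

variable (K) in
/-- A system of conjugators for all the automorphisms having one, as a `K`-basis of `B`. -/
def basis : Module.Basis N K B :=
  .mk (hB.linearIndependent_conjugators K hj u.ne_zero u.isConjugator)
    (hB.span_conjugators K u.ne_zero u.isConjugator hr).ge

@[simp]
theorem basis_apply (x : N) : u.basis K hB hj hr x = u x := Module.Basis.mk_apply _ _ x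

end ConjugatorSystem

section Commutative

theorem mul_comm_of_le {G : Type*} [Group G] {N S : Subgroup G} (hNS : N ≤ S)
    (hS : ∀ s t : S, s * t = t * s) (x y : N) : x * y = y * x :=
  Subgroup.inclusion_injective hNS (hS (Subgroup.inclusion hNS x) (Subgroup.inclusion hNS y))

theorem conjIn_eq_self {G : Type*} [Group G] {N S : Subgroup G} (hNS : N ≤ S)
    (hS : ∀ s t : S, s * t = t * s) (g : S) (hg : ∀ x ∈ N, (g : G) * x * (g : G)⁻¹ ∈ N) (x : N) :
    conjIn N g hg x = x :=
  Subtype.ext (mul_inv_eq_of_eq_mul (congrArg Subtype.val (hS g (Subgroup.inclusion hNS x))))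

variable {k K G : Type*} [Field k] [Field K] [Algebra k K] [Group G] {S : Subgroup G}
  {B : Type*} [Ring B] [Algebra k B] [Algebra K B] [IsScalarTower k K B] [IsSimpleRing B]
  [Algebra.IsCentral K B] [MulSemiringAction S B] [SMulCommClass S k B]

variable (k K S B) in
/-- The kernel of the action of `S` on the center `K` of `B`, as a subgroup of `G`. -/
def centerKer : Subgroup G := (centerHom k K S B).ker.map S.subtype

variable (k K S B) in
theorem centerKer_le : centerKer k K S B ≤ S := Subgroup.map_subtype_le _

theorem centerHom_inclusion_centerKer (x : centerKer k K S B) :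
    centerHom k K S B (Subgroup.inclusion (centerKer_le k K S B) x) = 1 := by
  obtain ⟨_, s, hs, rfl⟩ := x
  exact hs

theorem subgroupOf_centerKer : (centerKer k K S B).subgroupOf S = (centerHom k K S B).ker :=
  Subgroup.comap_map_eq_self_of_injective S.subtype_injective _

theorem mem_range_inclusion_of_isConjugator {s : S} {v : B} (h0 : v ≠ 0) (hv : IsConjugator s v) :
    s ∈ Set.range (Subgroup.inclusion (centerKer_le k K S B)) :=
  ⟨⟨s, s, hv.centerHom_eq_one h0, rfl⟩, rfl⟩

namespace ConjugatorSystem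

variable [Finite G] [IsDedekindFiniteMonoid B] [CharZero k] [IsGalois k K]
  (u : ConjugatorSystem (Subgroup.inclusion (centerKer_le k K S B)) B)
  (hB : IsGaloisAlgebra k S B) (hS : ∀ s t : S, s * t = t * s)

/-- The Galois datum of an `S`-Galois algebra with center `K`, for `S` commutative: `N` is the
kernel of the action on the center, and `(σ, γ)` describes the multiplication of and the action
on a system of conjugators for `N`. -/
def galoisDatum : GaloisDatum k K G where
  S := S
  N := centerKer k K S B
  N_le := centerKer_le k K S B
  conj_mem g hg x hx := by
    have hgx := congrArg Subtype.val (hS ⟨g, hg⟩ ⟨x, centerKer_le k K S B hx⟩)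
    exact (mul_inv_eq_of_eq_mul hgx).symm ▸ hx
  isGalois := inferInstance
  toGal := centerHom k K S B
  toGal_surjective := hB.centerHom_surjective
  toGal_ker := subgroupOf_centerKer.symm
  not_char_dvd := by
    rw [ringChar.eq_zero, zero_dvd_iff]
    exact Nat.card_pos.ne'
  σ := u.twoCocycle K
  nondegenerate := u.isNondegenerate hB (Subgroup.inclusion_injective _)
    (mul_comm_of_le (centerKer_le k K S B) hS) fun _ _ => mem_range_inclusion_of_isConjugator
  γ := u.eigenvalue K fun s _ => hS s _
  γ_one_left := u.eigenvalue_one_left _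
  γ_one_right := u.eigenvalue_one_right _
  γ_mul_right g x y := by
    rw [conjIn_eq_self (centerKer_le k K S B) hS, conjIn_eq_self (centerKer_le k K S B) hS]
    exact u.eigenvalue_mul_right _ g x y
  γ_mul_left g h x := by
    rw [conjIn_eq_self (centerKer_le k K S B) hS]
    exact u.eigenvalue_mul_left _ g h x
  γ_eq_inner x y := by
    have hN := mul_comm_of_le (centerKer_le k K S B) hS
    rw [TwoCocycle.inner_eq_alt _ hN]
    exact u.eigenvalue_eq_alt _ (hN x y)

theorem isomorphic_galoisDatum_ind :
    GAlgIsomorphic k G (inducedAlgebra k S B) (u.galoisDatum hB hS).Ind := by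
  let : MulSemiringAction (u.galoisDatum hB hS).S B := ‹MulSemiringAction S B›
  have : SMulCommClass (u.galoisDatum hB hS).S k B := ‹SMulCommClass S k B›
  let b := u.basis K hB (Subgroup.inclusion_injective _)
    fun _ _ => mem_range_inclusion_of_isConjugator
  have hb (x : centerKer k K S B) : b x = u x := u.basis_apply hB _ _ x
  have hmul (x y : centerKer k K S B) : b x * b y = (u.twoCocycle K x y : K) • b (x * y) := by
    rw [hb, hb, hb, u.mul_eq K]
  have hconj (g : S) (x : centerKer k K S B) : (u.galoisDatum hB hS).conjS g x = x :=
    conjIn_eq_self (centerKer_le k K S B) hS g _ x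
  have hact (g : S) (α : K) (x : centerKer k K S B) : g • α • b x =
      (centerHom k K S B g α * u.eigenvalue K (fun s _ => hS s _) g x) • b x := by
    rw [hb, smul_smul_eq_centerHom_smul k K, ← u.eigenvalue_smul (K := K) (fun s _ => hS s _),
      smul_smul]
  exact ((u.galoisDatum hB hS).isomorphic_alg b ((hb 1).trans u.map_one) hmul fun g α x =>
    (hact g α x).trans (congrArg (_ • b ·) (hconj g x).symm)).symm.induced

end ConjugatorSystem

end Commutative

/-! ### Simple algebras over a real closed field -/

theorem exists_algebra_of_center_algEquiv {k K B : Type*} [Field k] [Field K] [Algebra k K]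
    [Ring B] [Algebra k B] (e : K ≃ₐ[k] Subalgebra.center k B) :
    ∃ (_ : Algebra K B), IsScalarTower k K B ∧ Algebra.IsCentral K B := by
  let θ : K →ₐ[k] B := (Subalgebra.center k B).val.comp e
  let _ : Algebra K B := θ.toRingHom.toAlgebra' fun α b =>
    (Subalgebra.mem_center_iff.mp (e α).2 b).symm
  refine ⟨_, .of_algebraMap_eq fun a => (θ.commutes a).symm, ⟨fun z hz => ?_⟩⟩
  have hz' : z ∈ Subalgebra.center k B := Subalgebra.mem_center_iff.mpr
    (Subalgebra.mem_center_iff.mp hz)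
  exact Algebra.mem_bot.mpr ⟨e.symm ⟨z, hz'⟩, congrArg Subtype.val (e.apply_symm_apply ⟨z, hz'⟩)⟩

theorem isCentral_or_exists_algebra_adjoinI (k B : Type*) [Field k] [IsRealClosed k] [Ring B]
    [Algebra k B] [IsSimpleRing B] [FiniteDimensional k B] :
    Algebra.IsCentral k B ∨
      ∃ (_ : Algebra (AdjoinI k) B), IsScalarTower k (AdjoinI k) B ∧
        Algebra.IsCentral (AdjoinI k) B := by
  let _ : Field (Subalgebra.center k B) :=
    IsField.toField (R := Subalgebra.center k B) (IsSimpleRing.isField_center B)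
  rcases nonempty_algEquiv_or_adjoinI k (Subalgebra.center k B) with ⟨⟨e⟩⟩ | ⟨⟨e⟩⟩
  · refine .inl ⟨fun z hz => Algebra.mem_bot.mpr ⟨e ⟨z, hz⟩, ?_⟩⟩
    exact congrArg Subtype.val ((e.symm.commutes _).symm.trans (e.symm_apply_apply ⟨z, hz⟩))
  · exact .inr (exists_algebra_of_center_algEquiv e.symm)

theorem centerHom_eq_of_forall_map_smul {k K Γ B : Type*} [Field k] [Field K] [Algebra k K]
    [Ring B] [Nontrivial B] [Algebra k B] [Algebra K B] [IsScalarTower k K B]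
    [Algebra.IsCentral K B] [Group Γ] [MulSemiringAction Γ B] [SMulCommClass Γ k B] {s t : Γ}
    (ψ : B ≃ₐ[K] B) (h : ∀ b, ψ (s • b) = t • ψ b) :
    centerHom k K Γ B s = centerHom k K Γ B t := by
  refine AlgEquiv.ext fun α => (algebraMap K B).injective ?_
  rw [← ψ.commutes, algebraMap_centerHom, h, ψ.commutes, algebraMap_centerHom]

/-! ### Normalized systems of conjugators -/

theorem mem_zpowers_neg_one_of_sq_eq_one {K : Type*} [Field K] {α : Kˣ} (h : (α : K) ^ 2 = 1) :
    α ∈ Subgroup.zpowers (-1 : Kˣ) := by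
  rcases sq_eq_one_iff.mp h with h | h
  · obtain rfl : α = 1 := Units.ext h
    exact one_mem _
  · obtain rfl : α = -1 := Units.ext h
    exact Subgroup.mem_zpowers _

theorem exists_smul_pow_four_eq_one {k B : Type*} [Field k] [IsRealClosed k] [Ring B] [Algebra k B]
    {u : B} {a : k} (ha : a ≠ 0) (hu : u * u = a • 1) : ∃ c : k, c ≠ 0 ∧ (c • u) ^ 4 = 1 := by
  obtain ⟨b, hb⟩ : ∃ b : k, b ^ 4 = a ^ 2 := by
    rcases IsRealClosed.isSquare_or_isSquare_neg a with ⟨b, hb⟩ | ⟨b, hb⟩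
    · exact ⟨b, by rw [hb]; ring⟩
    · exact ⟨b, by rw [← neg_sq, hb]; ring⟩
  have hb0 : b ^ 4 ≠ 0 := hb ▸ pow_ne_zero 2 ha
  refine ⟨b⁻¹, inv_ne_zero (pow_ne_zero_iff four_ne_zero |>.mp hb0), ?_⟩
  have hu4 : u ^ 4 = b ^ 4 • (1 : B) := by
    rw [hb, pow_mul u 2 2, sq u, hu, smul_pow, one_pow]
  rw [smul_pow, hu4, smul_smul, inv_pow, inv_mul_cancel₀ hb0, one_smul]

namespace ConjugatorSystem

theorem exists_of_forall_exists {N S B : Type*} [Group N] [Group S] [Ring B] [Nontrivial B]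
    [MulSemiringAction S B] (j : N →* S) {p : B → Prop} (hone : p 1)
    (h : ∀ x, ∃ u, u ≠ 0 ∧ IsConjugator (j x) u ∧ p u) :
    ∃ u : ConjugatorSystem j B, ∀ x, p (u x) := by
  classical
  choose v hv0 hv hpv using h
  have hupd (q : N → B → Prop) (h1 : q 1 1) (hq : ∀ x, q x (v x)) (x : N) :
      q x (Function.update v 1 1 x) := by
    by_cases hx : x = 1
    · rw [hx, Function.update_self]
      exact h1
    · rw [Function.update_of_ne hx]
      exact hq x
  exact ⟨⟨Function.update v 1 1, Function.update_self 1 1 v,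
    hupd (fun _ u => u ≠ 0) one_ne_zero hv0,
    hupd (fun x u => IsConjugator (j x) u) ((_root_.map_one j).symm ▸ .one) hv⟩,
    hupd (fun _ u => p u) hone hpv⟩

section ConjNormal

variable {k K G B : Type*} [Field k] [Field K] [Algebra k K] [Group G] {N S : Subgroup G}
  [N.Normal] [Ring B] [Algebra k B] [Algebra K B] [IsScalarTower k K B] [IsSimpleRing B]
  [IsDedekindFiniteMonoid B] [Algebra.IsCentral K B] [MulSemiringAction S B] [SMulCommClass S k B]
  {hNS : N ≤ S}

theorem exists_coboundary_conjNormal (u : ConjugatorSystem (Subgroup.inclusion hNS) B)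
    (hc : ∀ s x, s * Subgroup.inclusion hNS x = Subgroup.inclusion hNS x * s) {n : ℕ}
    (hu : ∀ x, u x ^ n = 1) {g : G} {ψ : B ≃ₐ[K] B}
    (hψ : ∀ s t : S, t.1 = g * s.1 * g⁻¹ → ∀ b, ψ (s • b) = t • ψ b) :
    ∃ η : N → Kˣ, (∀ x, (η x : K) ^ n = 1) ∧ η 1 = 1 ∧
      (∀ x y, u.twoCocycle K (MulAut.conjNormal g x) (MulAut.conjNormal g y) =
        u.twoCocycle K x y * (η y * η x / η (x * y))) ∧
      ∀ s t : S, t.1 = g * s.1 * g⁻¹ → ∀ x,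
        (u.eigenvalue K hc t (MulAut.conjNormal g x) : K) =
          u.eigenvalue K hc s x * (centerHom k K S B s (η x : K) / η x) := by
  let c : N →* N := (MulAut.conjNormal g : N ≃* N).toMonoidHom
  have hψc (x : N) (b : B) : ψ (Subgroup.inclusion hNS x • b) =
      (Subgroup.inclusion hNS).comp c x • ψ b := hψ _ _ rfl b
  obtain ⟨η, hη, hη1, hησ⟩ := exists_coboundary (K := K) (u.map ψ.toRingEquiv hψc) (u.comp c)
  refine ⟨η, fun x => pow_eq_one_of_smul_pow_eq_one (v := ψ (u x)) ?_ (hη x ▸ hu (c x)), hη1,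
    fun x y => ?_, fun s t hst x => ?_⟩
  · rw [← _root_.map_pow, hu, _root_.map_one]
  · rw [← u.twoCocycle_map ψ hψc x y, ← hησ]
    exact (u.twoCocycle_comp c x y).symm
  · have h := eigenvalue_eq_mul_div (k := k) (fun s x => hc s (c x)) _ _ hη t x
    rw [u.eigenvalue_comp hc, u.eigenvalue_map hc _ ψ hψc (hψ s t hst)] at h
    rw [centerHom_eq_of_forall_map_smul ψ (hψ s t hst)]
    exact h

end ConjNormal

end ConjugatorSystem

/-! ### Real torsor data -/

section Real

variable {k G Γ B : Type*} [Field k] [IsRealClosed k] [Group G] [Finite G] {S : Subgroup G}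
  [Ring B] [Algebra k B] [IsSimpleRing B] [Algebra.IsCentral k B] [MulSemiringAction S B]
  [SMulCommClass S k B]

variable (Γ) in
theorem IsGaloisAlgebra.isElementaryAbelianTwo [Group Γ] [MulSemiringAction Γ B]
    [SMulCommClass Γ k B] [SMulCommClass Γ S B] [FaithfulSMul Γ B] (hB : IsGaloisAlgebra k S B)
    (hcard : Nat.card S ≤ Nat.card Γ) : IsElementaryAbelianTwo S where
  comm x hx y hy := congrArg Subtype.val (hB.mul_comm_of_centerHom_eq_one (K := k) Γ hcard
    (x := ⟨x, hx⟩) (y := ⟨y, hy⟩) (Subsingleton.elim _ _) (Subsingleton.elim _ _))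
  sq_eq_one x hx := by
    let z : (centerHom k k S B).ker := ⟨⟨x, hx⟩, Subsingleton.elim _ _⟩
    have hz : z ^ 2 = 1 := hB.eq_of_forall_isEquivariantCharacter_eq Γ hcard fun χ _ => by
      rw [map_pow, map_one]
      refine sq_eq_one_of_pow_eq_one (n := Nat.card (centerHom k k S B).ker) Nat.card_pos.ne' ?_
      rw [← map_pow, pow_card_eq_one', map_one]
    exact congrArg (fun z => z.1.1) hz

theorem IsGaloisAlgebra.exists_conjugatorSystem_pow_four_eq_one (hB : IsGaloisAlgebra k S B)
    (hS : IsElementaryAbelianTwo S) :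
    ∃ u : ConjugatorSystem (Subgroup.inclusion (le_refl S)) B, ∀ x, u x ^ 4 = 1 := by
  have := hB.isNoetherianRing
  refine ConjugatorSystem.exists_of_forall_exists _ (p := fun u => u ^ 4 = 1) (one_pow 4)
    fun x => ?_
  obtain ⟨u, hu0, hu⟩ := hB.exists_conjugator (K := k) (s := x) (Subsingleton.elim _ _)
  have huu : u * u ≠ 0 := ((hu.isUnit hu0).mul (hu.isUnit hu0)).ne_zero
  have hx : x * x = 1 := Subtype.ext (by rw [← sq]; exact hS.sq_eq_one x x.2)
  obtain ⟨α, hα⟩ := IsConjugator.one.exists_smul_eq k one_ne_zero (hx ▸ hu.mul hu)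
  have hα0 : α ≠ 0 := fun h => huu (by rw [← hα, h, zero_smul])
  obtain ⟨c, hc0, hc⟩ := exists_smul_pow_four_eq_one hα0 hα.symm
  exact ⟨c • u, smul_ne_zero hc0 hu0, hu.smul c, hc⟩

namespace ConjugatorSystem

variable [IsDedekindFiniteMonoid B] (u : ConjugatorSystem (Subgroup.inclusion (le_refl S)) B)
  (hB : IsGaloisAlgebra k S B) (hS : IsElementaryAbelianTwo S) (hu : ∀ x, u x ^ 4 = 1)
  (hconj : IsConjStable k S B)

/-- The real torsor datum `(S, σ)` of a central simple `S`-Galois algebra, for `S` elementary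
abelian of exponent 2 and a system of conjugators normalized by `u x ^ 4 = 1`: then `σ` has
values in `μ₄(k) = μ₂`. -/
def realTorsorDatum [S.Normal] : RealTorsorDatum k G :=
  have hcomm (x y : S) : x * y = y * x := Subtype.ext (hS.comm x x.2 y y.2)
  { N := S
    N_normal := inferInstance
    elementary := hS
    σ := u.twoCocycle k
    σ_mem_two := fun x y => by
      have hx : x ^ 2 = 1 := Subtype.ext (hS.sq_eq_one x x.2)
      exact mem_zpowers_neg_one_of_sq_eq_one (sq_eq_one_of_pow_eq_one four_ne_zero
        (u.twoCocycle_pow_four_eq_one hu (hcomm x y) (u.alt_pow_eq_one k (hcomm x y) hx)))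
    nondegenerate := u.isNondegenerate hB (Subgroup.inclusion_injective _) hcomm
      fun s _ _ _ => ⟨s, rfl⟩
    cohomologous := fun g => by
      obtain ⟨ψ, hψ⟩ := hconj g
      obtain ⟨η, hη4, hη1, hησ, -⟩ := u.exists_coboundary_conjNormal (k := k)
        (fun s x => hcomm s x) hu hψ
      exact ⟨η, fun x => mem_zpowers_neg_one_of_sq_eq_one
        (sq_eq_one_of_pow_eq_one four_ne_zero (hη4 x)), hη1, hησ⟩ }

theorem isomorphic_realTorsorDatum_ind [S.Normal] :
    GAlgIsomorphic k G (inducedAlgebra k S B)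
      (u.realTorsorDatum hB hS hu hconj).toGaloisDatum.Ind := by
  have hcomm (x y : S) : x * y = y * x := Subtype.ext (hS.comm x x.2 y y.2)
  let D := u.realTorsorDatum hB hS hu hconj
  let : MulSemiringAction D.N B := ‹MulSemiringAction S B›
  have : SMulCommClass D.N k B := ‹SMulCommClass S k B›
  let b := u.basis k hB (Subgroup.inclusion_injective _) fun s _ _ _ => ⟨s, rfl⟩
  have hb (x : S) : b x = u x := u.basis_apply hB _ _ x
  refine D.isomorphic_ind b ((hb 1).trans u.map_one) (fun x y => ?_) fun g x => ?_
  · exact (congrArg₂ _ (hb x) (hb y)).trans ((u.mul_eq k x y).trans (congrArg _ (hb _).symm))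
  · exact (congrArg _ (hb x)).trans
      ((u.smul_eq_alt k (hcomm g x)).trans (congrArg _ (hb x).symm))

end ConjugatorSystem

variable (Γ) in
theorem IsGaloisAlgebra.exists_realTorsorDatum [Group Γ] [MulSemiringAction Γ B]
    [SMulCommClass Γ k B] [SMulCommClass Γ S B] [FaithfulSMul Γ B] (hB : IsGaloisAlgebra k S B)
    (hcard : Nat.card S ≤ Nat.card Γ) (hS : S.Normal) (hconj : IsConjStable k S B) :
    ∃ D : RealTorsorDatum k G, GAlgIsomorphic k G (inducedAlgebra k S B) D.toGaloisDatum.Ind := by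
  have := hB.isNoetherianRing
  have hS2 := hB.isElementaryAbelianTwo Γ hcard
  obtain ⟨u, hu⟩ := hB.exists_conjugatorSystem_pow_four_eq_one hS2
  exact ⟨_, u.isomorphic_realTorsorDatum_ind hB hS2 hu hconj⟩

end Real

/-! ### Galois algebras with center `k(i)` -/

theorem mul_comm_of_forall_map_eq {S H : Type*} [Group S] [Group H] (f : S →* H) {g : S}
    (hf : ∀ s, f s = 1 ∨ f s = f g) (hker : ∀ x y, f x = 1 → f y = 1 → x * y = y * x)
    (hg : ∀ x, f x = 1 → g * x = x * g) (s t : S) : s * t = t * s := by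
  have comm_of_ker {s n : S} (hn : f n = 1) : s * n = n * s := by
    rcases hf s with hs | hs
    · exact hker s n hs hn
    · have hgs : f (g⁻¹ * s) = 1 := by rw [map_mul, map_inv, hs, inv_mul_cancel]
      rw [← mul_inv_cancel_left g s, mul_assoc, hker _ n hgs hn, ← mul_assoc, hg n hn, mul_assoc]
  rcases hf t with ht | ht
  · exact comm_of_ker ht
  rcases hf s with hs | hs
  · exact (comm_of_ker hs).symm
  · have hst : f (s⁻¹ * t) = 1 := by rw [map_mul, map_inv, hs, ht, inv_mul_cancel]
    rw [← mul_inv_cancel_left s t, mul_assoc, ← comm_of_ker hst]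

namespace IsGaloisAlgebra

variable {k S Γ B : Type*} [Field k] [IsRealClosed k] [Group S] [Finite S] [Ring B] [Algebra k B]
  [Algebra (AdjoinI k) B] [IsScalarTower k (AdjoinI k) B] [IsSimpleRing B]
  [Algebra.IsCentral (AdjoinI k) B] [MulSemiringAction S B] [SMulCommClass S k B]
  (hB : IsGaloisAlgebra k S B)

include hB

section Maximal

variable (Γ) [Group Γ] [MulSemiringAction Γ B] [SMulCommClass Γ k B] [SMulCommClass Γ S B]
  [FaithfulSMul Γ B] (hcard : Nat.card S ≤ Nat.card Γ)

include hcard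

theorem conj_mul_self_eq_one {g x : S} (hg : centerHom k (AdjoinI k) S B g ≠ 1)
    (hx : centerHom k (AdjoinI k) S B x = 1) : g * x * g⁻¹ * x = 1 := by
  let z : (centerHom k (AdjoinI k) S B).ker := ⟨x, hx⟩
  suffices h : MulAut.conjNormal g z * z = 1 from congrArg Subtype.val h
  refine hB.eq_of_forall_isEquivariantCharacter_eq Γ hcard fun χ hχ => ?_
  rw [map_mul, map_one, hχ]
  refine AdjoinI.apply_mul_eq_one_of_pow_eq_one hg
    (n := Nat.card (centerHom k (AdjoinI k) S B).ker) Nat.card_pos.ne' ?_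
  rw [mul_pow, ← map_pow, ← map_pow, pow_card_eq_one', map_one, map_one, mul_one]

/-- The eigenvalues of `x` on conjugators are roots of unity, and an automorphism commuting with
`S` and acting on `k(i)` by complex conjugation shows that they are real. -/
theorem mul_self_eq_one_of_centerHom_eq_one {x : S}
    (hx : centerHom k (AdjoinI k) S B x = 1) : x * x = 1 := by
  have := hB.isNoetherianRing
  obtain ⟨ω, hω⟩ := AdjoinI.exists_aut_ne_one k
  obtain ⟨φ, hφ⟩ := hB.centerHom_surjective_of_card_le (AdjoinI k) Γ hcard ω
  refine hB.eq_of_smul_conjugator_eq fun y u hu0 hu => ?_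
  have hy := hu.centerHom_eq_one (k := k) (K := AdjoinI k) hu0
  have hxy : x * y * x⁻¹ = y := by
    rw [hB.mul_comm_of_centerHom_eq_one Γ hcard hx hy, mul_inv_cancel_right]
  obtain ⟨β, hβ⟩ := hu.exists_smul_eq (AdjoinI k) hu0 (hxy ▸ hu.act x)
  obtain ⟨χ, hχ⟩ := hu.exists_smul_eq (AdjoinI k) hu0
    (hu.map (MulSemiringAction.toRingEquiv Γ B φ) fun b => smul_comm φ y b)
  replace hχ : χ • u = φ • u := hχ
  have hχ0 : χ ≠ 0 := by
    rintro rfl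
    rw [zero_smul, eq_comm, smul_eq_zero_iff_eq] at hχ
    exact hu0 hχ
  have hωβ : ω β = β := by
    have h : φ • x • u = x • φ • u := smul_comm φ x u
    rw [← hβ, smul_smul_eq_centerHom_smul k, hφ, ← hχ, smul_smul_eq_centerHom_smul k, hx,
      AlgEquiv.one_apply, ← hβ, smul_smul, smul_smul, mul_comm χ] at h
    exact mul_right_cancel₀ hχ0 (smul_left_injective (AdjoinI k) hu0 h)
  obtain ⟨a, rfl⟩ := AdjoinI.exists_eq_algebraMap_of_apply_eq hω hωβ
  have ha : a ^ 2 = 1 := by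
    refine sq_eq_one_of_pow_eq_one (n := Nat.card S) Nat.card_pos.ne' ?_
    refine (algebraMap k (AdjoinI k)).injective ?_
    rw [map_pow, map_one]
    exact pow_eq_one_of_smul_eq hx hu0 hβ.symm pow_card_eq_one'
  rw [mul_smul_eq_of_smul_eq k hβ.symm hβ.symm, hx, AlgEquiv.one_apply, ← map_mul, ← sq, ha,
    map_one, one_smul, one_smul]

theorem mul_comm_of_card_le (s t : S) : s * t = t * s := by
  obtain ⟨ω, hω⟩ := AdjoinI.exists_aut_ne_one k
  obtain ⟨g, rfl⟩ := hB.centerHom_surjective (K := AdjoinI k) ω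
  refine mul_comm_of_forall_map_eq (centerHom k (AdjoinI k) S B) (g := g) (fun s => ?_)
    (fun x y hx hy => hB.mul_comm_of_centerHom_eq_one Γ hcard hx hy) (fun x hx => ?_) s t
  · exact (eq_or_ne _ 1).imp_right fun hs => AdjoinI.eq_of_ne_one hs hω
  · have hxx := hB.mul_self_eq_one_of_centerHom_eq_one Γ hcard hx
    exact mul_inv_eq_iff_eq_mul.mp
      (mul_right_cancel ((hB.conj_mul_self_eq_one Γ hcard hω hx).trans hxx.symm))

end Maximal

variable (hcomm : ∀ s t : S, s * t = t * s)

include hcomm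

theorem mul_self_eq_one_of_centerHom_ne_one {g : S}
    (hg : centerHom k (AdjoinI k) S B g ≠ 1)
    (hsq : ∀ x : S, centerHom k (AdjoinI k) S B x = 1 → x * x = 1) : g * g = 1 := by
  have := hB.isNoetherianRing
  have hgg : centerHom k (AdjoinI k) S B (g * g) = 1 :=
    (map_mul _ g g).trans (AdjoinI.aut_mul_self _)
  refine hB.eq_of_smul_conjugator_eq fun y u hu0 hu => ?_
  have hgy : g * y * g⁻¹ = y := by rw [hcomm g y, mul_inv_cancel_right]
  obtain ⟨χ, hχ⟩ := hu.exists_smul_eq (AdjoinI k) hu0 (hgy ▸ hu.act g)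
  have hggu := mul_smul_eq_of_smul_eq k hχ.symm hχ.symm
  rw [hggu, AdjoinI.apply_mul_eq_one_of_pow_eq_one hg two_ne_zero
    (pow_eq_one_of_smul_eq hgg hu0 hggu (by rw [sq, hsq _ hgg])), one_smul, one_smul]

omit [Finite S] hB in
theorem exists_isConjugator_smul_eq_self [IsDedekindFiniteMonoid B] {g : S}
    (hg : centerHom k (AdjoinI k) S B g ≠ 1) (hgg : g * g = 1) {x : S} {u : B} (hu0 : u ≠ 0)
    (hu : IsConjugator x u) : ∃ v : B, v ≠ 0 ∧ IsConjugator x v ∧ g • v = v := by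
  have hgx : g * x * g⁻¹ = x := by rw [hcomm g x, mul_inv_cancel_right]
  obtain ⟨χ, hχ⟩ := hu.exists_smul_eq (AdjoinI k) hu0 (hgx ▸ hu.act g)
  have hχ1 : centerHom k (AdjoinI k) S B g χ * χ = 1 := by
    refine smul_left_injective (AdjoinI k) hu0 ?_
    change _ • u = (1 : AdjoinI k) • u
    rw [← mul_smul_eq_of_smul_eq k hχ.symm hχ.symm, hgg, one_smul, one_smul]
  obtain ⟨c, hc0, hc⟩ := AdjoinI.exists_apply_mul_eq hg hχ1
  exact ⟨c • u, smul_ne_zero hc0 hu0, hu.smul c, by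
    rw [smul_smul_eq_centerHom_smul k (AdjoinI k), ← hχ, smul_smul, hc]⟩

omit [Finite S] hB in
theorem exists_isConjugator_smul_eq_self_pow_four_eq_one [IsDedekindFiniteMonoid B] {g : S}
    (hg : centerHom k (AdjoinI k) S B g ≠ 1) (hgg : g * g = 1) {x : S} (hxx : x * x = 1) {u : B}
    (hu0 : u ≠ 0) (hu : IsConjugator x u) :
    ∃ v : B, v ≠ 0 ∧ IsConjugator x v ∧ g • v = v ∧ v ^ 4 = 1 := by
  obtain ⟨w, hw0, hw, hgw⟩ := exists_isConjugator_smul_eq_self hcomm hg hgg hu0 hu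
  have hww : w * w ≠ 0 := ((hw.isUnit hw0).mul (hw.isUnit hw0)).ne_zero
  obtain ⟨α, hα⟩ := IsConjugator.one.exists_smul_eq (AdjoinI k) one_ne_zero (hxx ▸ hw.mul hw)
  have hgα : centerHom k (AdjoinI k) S B g α = α := by
    have h : g • α • (1 : B) = α • (1 : B) := by rw [hα, smul_mul', hgw]
    rw [smul_smul_eq_centerHom_smul k, smul_one] at h
    exact smul_left_injective (AdjoinI k) one_ne_zero h
  obtain ⟨a, rfl⟩ := AdjoinI.exists_eq_algebraMap_of_apply_eq hg hgα
  rw [algebraMap_smul] at hα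
  obtain ⟨c, hc0, hc⟩ := exists_smul_pow_four_eq_one
    (fun ha : a = 0 => hww (by rw [← hα, ha, zero_smul])) hα.symm
  refine ⟨c • w, smul_ne_zero hc0 hw0, ?_, by rw [smul_comm, hgw], hc⟩
  rw [← algebraMap_smul (AdjoinI k) c w]
  exact hw.smul _

end IsGaloisAlgebra

/-! ### Semi-real torsor data -/

theorem algEquiv_apply_eq_self_of_sq_eq_one {k K : Type*} [Field k] [Field K] [Algebra k K]
    (ω : K ≃ₐ[k] K) {z : K} (hz : z ^ 2 = 1) : ω z = z := by
  rcases sq_eq_one_iff.mp hz with rfl | rfl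
  · exact map_one ω
  · rw [map_neg, map_one]

theorem mem_range_unitsMap_algebraMap_of_sq_eq_one (k : Type*) {K : Type*} [Field k] [Field K]
    [Algebra k K] {α : Kˣ} (h : (α : K) ^ 2 = 1) :
    α ∈ (Units.map (algebraMap k K : k →* K)).range := by
  refine Subgroup.zpowers_le.mpr ?_ (mem_zpowers_neg_one_of_sq_eq_one h)
  exact ⟨-1, Units.ext ((map_neg (algebraMap k K) 1).trans (congrArg _ (map_one _)))⟩

theorem exists_isPrimitiveRoot_exponent {k N : Type*} [Field k] [CharZero k] [Group N]
    (hN : ∀ x : N, x ^ 2 = 1) : ∃ ζ : k, IsPrimitiveRoot ζ (Monoid.exponent N) := by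
  rcases (Nat.dvd_prime Nat.prime_two).mp (Monoid.exponent_dvd_of_forall_pow_eq_one hN) with h | h
  · exact ⟨1, h ▸ IsPrimitiveRoot.one⟩
  · exact ⟨-1, h ▸ IsPrimitiveRoot.neg_one 0 two_ne_zero.symm⟩

section ConjStable

variable {k K G : Type*} [Field k] [Field K] [Algebra k K] [Group G] {S : Subgroup G}
  {B : Type*} [Ring B] [Algebra k B] [Algebra K B] [IsScalarTower k K B] [IsSimpleRing B]
  [Algebra.IsCentral K B] [MulSemiringAction S B] [SMulCommClass S k B]
  (hconj : IsConjStable k S B) (hsurj : Function.Surjective (centerHom k K S B))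
  (hS : ∀ s t : S, s * t = t * s)

include hconj hsurj hS

/-- An intertwining automorphism can be corrected by an element of `S` with the inverse action on
the center, because `S` is commutative. -/
theorem IsConjStable.exists_center_algEquiv (g : G) :
    ∃ ψ : B ≃ₐ[K] B, ∀ s t : S, t.1 = g * s.1 * g⁻¹ → ∀ b, ψ (s • b) = t • ψ b := by
  obtain ⟨ψ, hψ⟩ := hconj g
  obtain ⟨r, hr⟩ := hsurj (centerHom k K (B ≃ₐ[k] B) B ψ)⁻¹
  let φ : B ≃ₐ[k] B := ψ.trans (MulSemiringAction.toAlgEquiv k B r)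
  have hφ (α : K) : φ (algebraMap K B α) = algebraMap K B α := by
    change r • ψ • algebraMap K B α = _
    rw [← algebraMap_centerHom k K, ← algebraMap_centerHom k K, hr, ← AlgEquiv.mul_apply,
      inv_mul_cancel, AlgEquiv.one_apply]
  refine ⟨AlgEquiv.ofRingEquiv (f := φ.toRingEquiv) hφ, fun s t hst b => ?_⟩
  change r • ψ (s • b) = t • r • ψ b
  rw [hψ s t hst, smul_smul, smul_smul, hS]

theorem centerKer_normal (hSn : S.Normal) : (centerKer k K S B).Normal := by
  refine ⟨?_⟩
  rintro _ ⟨s, hs, rfl⟩ g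
  obtain ⟨ψ, hψ⟩ := hconj.exists_center_algEquiv hsurj hS g
  let t : S := ⟨g * s.1 * g⁻¹, hSn.conj_mem s s.2 g⟩
  exact ⟨t, (centerHom_eq_of_forall_map_smul (k := k) ψ (hψ s t rfl)).symm.trans hs, rfl⟩

omit hsurj

theorem ConjugatorSystem.cohomologousIn_galoisDatum [Finite G] [IsDedekindFiniteMonoid B]
    [CharZero k] [IsGalois k K] [S.Normal] [(centerKer k K S B).Normal]
    (u : ConjugatorSystem (Subgroup.inclusion (centerKer_le k K S B)) B)
    (hB : IsGaloisAlgebra k S B) {n : ℕ} (hu : ∀ x, u x ^ n = 1) (g : G) :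
    (u.galoisDatum hB hS).CohomologousIn (rootsOfUnity n K)
      (fun x y => u.twoCocycle K (MulAut.conjNormal g x) (MulAut.conjNormal g y))
      (fun s x => u.eigenvalue K (fun s _ => hS s _) (MulAut.conjNormal g s)
        (MulAut.conjNormal g x)) := by
  obtain ⟨ψ, hψ⟩ := hconj.exists_center_algEquiv (hB.centerHom_surjective (K := K)) hS g
  obtain ⟨η, hηn, hη1, hησ, hηγ⟩ :=
    u.exists_coboundary_conjNormal (k := k) (fun s _ => hS s _) hu hψ
  refine ⟨η, fun x => (mem_rootsOfUnity' n _).mpr (hηn x), hη1, hησ, fun s x => ?_⟩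
  have hx : (u.galoisDatum hB hS).conjS s x = x := conjIn_eq_self (centerKer_le k K S B) hS s _ x
  rw [hx]
  exact hηγ s _ rfl x

end ConjStable

namespace AdjoinI

/-- For `g` of order dividing 2, the homomorphism `Gal(k(i)|k) → S` sending complex conjugation
to `g`. It is the splitting of a semi-real torsor datum. -/
def autLift (k : Type*) [Field k] [IsSemireal k] {S : Type*} [Group S] (g : S) (hg : g * g = 1) :
    (AdjoinI k ≃ₐ[k] AdjoinI k) →* S :=
  open Classical in
  { toFun := fun τ => if τ = 1 then 1 else g
    map_one' := if_pos rfl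
    map_mul' := fun τ τ' => by
      by_cases hτ : τ = 1
      · rw [hτ, one_mul, if_pos rfl, one_mul]
      · by_cases hτ' : τ' = 1
        · rw [hτ', mul_one, if_pos rfl, mul_one]
        · rw [eq_of_ne_one hτ hτ', aut_mul_self, if_pos rfl, if_neg hτ', hg] }

theorem autLift_eq_one_or {k S : Type*} [Field k] [IsSemireal k] [Group S] {g : S}
    (hg : g * g = 1) (τ : AdjoinI k ≃ₐ[k] AdjoinI k) :
    autLift k g hg τ = 1 ∧ τ = 1 ∨ autLift k g hg τ = g ∧ τ ≠ 1 := by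
  by_cases hτ : τ = 1
  · exact .inl ⟨if_pos hτ, hτ⟩
  · exact .inr ⟨if_neg hτ, hτ⟩

end AdjoinI

section SemiReal

variable {k G Γ B : Type*} [Field k] [IsRealClosed k] [Group G] {S : Subgroup G}
  [Ring B] [Algebra k B] [Algebra (AdjoinI k) B] [IsScalarTower k (AdjoinI k) B] [IsSimpleRing B]
  [Algebra.IsCentral (AdjoinI k) B] [MulSemiringAction S B] [SMulCommClass S k B]

omit [IsRealClosed k] in
theorem isElementaryAbelianTwo_centerKer (hS : ∀ s t : S, s * t = t * s)
    (hsq : ∀ s : S, centerHom k (AdjoinI k) S B s = 1 → s * s = 1) :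
    IsElementaryAbelianTwo (centerKer k (AdjoinI k) S B) where
  comm x hx y hy := congrArg Subtype.val
    (mul_comm_of_le (centerKer_le k (AdjoinI k) S B) hS ⟨x, hx⟩ ⟨y, hy⟩)
  sq_eq_one := by
    rintro _ ⟨s, hs, rfl⟩
    exact (sq _).trans (congrArg Subtype.val (hsq s hs))

namespace ConjugatorSystem

variable [IsDedekindFiniteMonoid B]
  (u : ConjugatorSystem (Subgroup.inclusion (centerKer_le k (AdjoinI k) S B)) B)
  (hS : ∀ s t : S, s * t = t * s)
  (hsq : ∀ s : S, centerHom k (AdjoinI k) S B s = 1 → s * s = 1)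
  {g : S} (hg : centerHom k (AdjoinI k) S B g ≠ 1) (hgu : ∀ x, g • u x = u x)

include hS hsq hg hgu

theorem eigenvalue_sq_eq_one (s : S) (x : centerKer k (AdjoinI k) S B) :
    (u.eigenvalue (AdjoinI k) (fun s _ => hS s _) s x : AdjoinI k) ^ 2 = 1 := by
  have of_ker {n : S} (hn : centerHom k (AdjoinI k) S B n = 1) :
      (u.eigenvalue (AdjoinI k) (fun s _ => hS s _) n x : AdjoinI k) ^ 2 = 1 :=
    pow_eq_one_of_smul_eq hn (u.ne_zero x) (u.eigenvalue_smul (K := AdjoinI k) _ n x).symm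
      (by rw [sq, hsq n hn])
  by_cases hs : centerHom k (AdjoinI k) S B s = 1
  · exact of_ker hs
  · have hn : centerHom k (AdjoinI k) S B (g⁻¹ * s) = 1 := by
      rw [_root_.map_mul, map_inv, AdjoinI.eq_of_ne_one hs hg, inv_mul_cancel]
    rw [← mul_inv_cancel_left g s, eigenvalue_mul_left (k := k), u.eigenvalue_eq_one _ (hgu x),
      Units.val_one, mul_one, ← _root_.map_pow, of_ker hn, _root_.map_one]

theorem twoCocycle_sq_eq_one (hu : ∀ x, u x ^ 4 = 1) (x y : centerKer k (AdjoinI k) S B) :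
    (u.twoCocycle (AdjoinI k) x y : AdjoinI k) ^ 2 = 1 := by
  have hxy := mul_comm_of_le (centerKer_le k (AdjoinI k) S B) hS x y
  have hfix : centerHom k (AdjoinI k) S B g (u.twoCocycle (AdjoinI k) x y) =
      u.twoCocycle (AdjoinI k) x y := by
    refine smul_left_injective (AdjoinI k) (u.ne_zero (x * y)) ?_
    have h : g • (u x * u y) = u x * u y := by rw [smul_mul', hgu, hgu]
    rwa [u.mul_eq (AdjoinI k), smul_smul_eq_centerHom_smul k, hgu] at h
  obtain ⟨a, ha⟩ := AdjoinI.exists_eq_algebraMap_of_apply_eq hg hfix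
  have halt : (u.twoCocycle (AdjoinI k)).alt x y ^ 2 = 1 := by
    rw [← u.eigenvalue_eq_alt (fun s _ => hS s _) hxy]
    exact Units.ext (u.eigenvalue_sq_eq_one hS hsq hg hgu _ y)
  have ha4 : a ^ 4 = 1 := (algebraMap k (AdjoinI k)).injective (by
    rw [_root_.map_pow, ← ha, _root_.map_one, u.twoCocycle_pow_four_eq_one hu hxy halt])
  rw [ha, ← _root_.map_pow, sq_eq_one_of_pow_eq_one four_ne_zero ha4, _root_.map_one]

theorem eigenvalue_mul_left_eq_mul (s t : S) (x : centerKer k (AdjoinI k) S B) :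
    u.eigenvalue (AdjoinI k) (fun s _ => hS s _) (s * t) x =
      u.eigenvalue (AdjoinI k) (fun s _ => hS s _) s x *
        u.eigenvalue (AdjoinI k) (fun s _ => hS s _) t x := by
  refine Units.ext ((u.eigenvalue_mul_left (k := k) (fun s _ => hS s _) s t x).trans ?_)
  rw [algEquiv_apply_eq_self_of_sq_eq_one _ (u.eigenvalue_sq_eq_one hS hsq hg hgu t x), mul_comm,
    Units.val_mul]

theorem eigenvalue_mul_right_eq_mul (hu : ∀ x, u x ^ 4 = 1) (s : S)
    (x y : centerKer k (AdjoinI k) S B) :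
    u.eigenvalue (AdjoinI k) (fun s _ => hS s _) s (x * y) =
      u.eigenvalue (AdjoinI k) (fun s _ => hS s _) s x *
        u.eigenvalue (AdjoinI k) (fun s _ => hS s _) s y := by
  have h := u.eigenvalue_mul_right (k := k) (K := AdjoinI k) (fun s _ => hS s _) s x y
  rw [algEquiv_apply_eq_self_of_sq_eq_one _ (u.twoCocycle_sq_eq_one hS hsq hg hgu hu x y),
    mul_assoc] at h
  exact Units.ext (mul_left_cancel₀ (Units.ne_zero _) h)

omit hsq hg in
theorem eigenvalue_autLift (hgg : g * g = 1) (τ : AdjoinI k ≃ₐ[k] AdjoinI k)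
    (x : centerKer k (AdjoinI k) S B) :
    u.eigenvalue (AdjoinI k) (fun s _ => hS s _) (AdjoinI.autLift k g hgg τ) x = 1 := by
  rcases AdjoinI.autLift_eq_one_or hgg τ with ⟨h, -⟩ | ⟨h, -⟩
  · rw [h, u.eigenvalue_one_left]
  · rw [h, u.eigenvalue_eq_one _ (hgu x)]

section Datum

variable [Finite G] [hSn : S.Normal] [hNn : (centerKer k (AdjoinI k) S B).Normal]
  (hB : IsGaloisAlgebra k S B)
  (hgg : g * g = 1) (hu : ∀ x, u x ^ 4 = 1) (hconj : IsConjStable k S B)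

/-- The semi-real torsor datum of an `S`-Galois algebra with center `k(i)`: `N` is the kernel of
the action of `S` on `k(i)`, the element `g` of order 2 splits `S = N ⊕ Gal(k(i)|k)`, and `(σ, γ)`
is given by a system of conjugators fixed by `g` and normalized by `u x ^ 4 = 1`. -/
def semiRealTorsorDatum : SemiRealTorsorDatum k G :=
  have hγ := u.eigenvalue_sq_eq_one hS hsq hg hgu
  have hσ := u.twoCocycle_sq_eq_one hS hsq hg hgu hu
  have hcoh := u.cohomologousIn_galoisDatum hconj hS hB hu
  have hN (x : centerKer k (AdjoinI k) S B) : x ^ 2 = 1 :=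
    Subtype.ext ((isElementaryAbelianTwo_centerKer hS hsq).sq_eq_one x x.2)
  { toGaloisDatum := u.galoisDatum hB hS
    S_comm := fun s hs t ht => congrArg Subtype.val (hS ⟨s, hs⟩ ⟨t, ht⟩)
    sec := AdjoinI.autLift k g hgg
    toGal_sec := fun τ => by
      rcases AdjoinI.autLift_eq_one_or hgg τ with ⟨h, rfl⟩ | ⟨h, hτ⟩
      · exact (congrArg _ h).trans (_root_.map_one _)
      · exact (congrArg _ h).trans (AdjoinI.eq_of_ne_one hg hτ)
    exists_primitiveRoot := exists_isPrimitiveRoot_exponent hN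
    σ_mem := fun x y => mem_range_unitsMap_algebraMap_of_sq_eq_one k (hσ x y)
    γ_mem := fun s x => mem_range_unitsMap_algebraMap_of_sq_eq_one k (hγ s x)
    γ_pairing_left := u.eigenvalue_mul_left_eq_mul hS hsq hg hgu
    γ_pairing_right := u.eigenvalue_mul_right_eq_mul hS hsq hg hgu hu
    γ_sec := u.eigenvalue_autLift hS hgu hgg
    γ_alt := fun x y => u.eigenvalue_eq_alt (fun s _ => hS s _)
      (mul_comm_of_le (centerKer_le k _ S B) hS x y)
    N_normal := hNn
    S_normal := hSn
    cohomologous := fun g => by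
      obtain ⟨η, -, hη⟩ := hcoh g
      exact ⟨η, fun _ => Subgroup.mem_top _, hη⟩
    isPGroup := fun x => ⟨1, by rw [pow_one]; exact hN x⟩
    σ_mem_two := fun x y => mem_zpowers_neg_one_of_sq_eq_one (hσ x y)
    cohomologous_four := hcoh }

end Datum

end ConjugatorSystem

namespace IsGaloisAlgebra

variable [Finite G] [Group Γ] [MulSemiringAction Γ B] [SMulCommClass Γ k B] [SMulCommClass Γ S B]
  [FaithfulSMul Γ B] (hB : IsGaloisAlgebra k S B)

include hB

omit Γ in
theorem exists_conjugatorSystem_smul_eq_self (hS : ∀ s t : S, s * t = t * s)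
    (hsq : ∀ s : S, centerHom k (AdjoinI k) S B s = 1 → s * s = 1) {g : S}
    (hg : centerHom k (AdjoinI k) S B g ≠ 1) (hgg : g * g = 1) :
    ∃ u : ConjugatorSystem (Subgroup.inclusion (centerKer_le k (AdjoinI k) S B)) B,
      ∀ x, g • u x = u x ∧ u x ^ 4 = 1 := by
  have := hB.isNoetherianRing
  refine ConjugatorSystem.exists_of_forall_exists _ (p := fun u => g • u = u ∧ u ^ 4 = 1)
    ⟨smul_one g, one_pow 4⟩ fun x => ?_
  have hx := centerHom_inclusion_centerKer (k := k) (K := AdjoinI k) x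
  obtain ⟨u, hu0, hu⟩ := hB.exists_conjugator (K := AdjoinI k) hx
  exact exists_isConjugator_smul_eq_self_pow_four_eq_one hS hg hgg (hsq _ hx) hu0 hu

variable (Γ) in
theorem exists_semiRealTorsorDatum (hcard : Nat.card S ≤ Nat.card Γ) (hS : S.Normal)
    (hconj : IsConjStable k S B) :
    ∃ D : SemiRealTorsorDatum k G,
      GAlgIsomorphic k G (inducedAlgebra k S B) D.toGaloisDatum.Ind ∧
        IsElementaryAbelianTwo D.N := by
  have := hB.isNoetherianRing
  have hcomm := hB.mul_comm_of_card_le Γ hcard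
  have hsq (s : S) (hs : centerHom k (AdjoinI k) S B s = 1) : s * s = 1 :=
    hB.mul_self_eq_one_of_centerHom_eq_one Γ hcard hs
  obtain ⟨ω, hω⟩ := AdjoinI.exists_aut_ne_one k
  obtain ⟨g, rfl⟩ := hB.centerHom_surjective (K := AdjoinI k) ω
  have hgg := hB.mul_self_eq_one_of_centerHom_ne_one hcomm hω hsq
  obtain ⟨u, hu⟩ := hB.exists_conjugatorSystem_smul_eq_self hcomm hsq hω hgg
  have := centerKer_normal hconj (hB.centerHom_surjective (K := AdjoinI k)) hcomm hS
  exact ⟨u.semiRealTorsorDatum hcomm hsq hω (fun x => (hu x).1) hB hgg (fun x => (hu x).2) hconj,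
    u.isomorphic_galoisDatum_ind hB hcomm, isElementaryAbelianTwo_centerKer hcomm hsq⟩

end IsGaloisAlgebra

end SemiReal

end

theorem mainTheorem4 {k G A : Type*} [Field k] [IsRealClosed k] [Group G] [Finite G]
    [Ring A] [Algebra k A] [MulSemiringAction G A] [SMulCommClass G k A]
    (hA : IsGaloisAlgebra k G A)
    (hcard : Nat.card (equivariantAut k G A) = Nat.card G) :
    (∃ D : SemiRealTorsorDatum k G,
      GAlgIsomorphic k G A D.toGaloisDatum.Ind ∧ IsElementaryAbelianTwo D.N) ∨
    (∃ D : RealTorsorDatum k G,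
      GAlgIsomorphic k G A D.toGaloisDatum.Ind ∧ IsElementaryAbelianTwo D.N) := by
  open scoped Pointwise in
  have := hA.nontrivial
  have := hA.finiteDimensional
  have := hA.isNoetherianRing
  obtain ⟨M, _⟩ := exists_isMaximalTwoSided A
  let Γ := equivariantAut k (MulAction.stabilizer G M) (A ⧸ M)
  have hB := hA.quotient M
  rcases isCentral_or_exists_algebra_adjoinI k (A ⧸ M) with _ | ⟨_, _, _⟩
  · have : Finite Γ := hB.finite_of_faithfulSMul k Γ
    have hle := hB.card_le_card k Γ
    obtain ⟨D, hD⟩ := hB.exists_realTorsorDatum Γ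
      (hA.card_stabilizer_le_card_equivariantAut_quotient hcard)
      (hA.stabilizer_normal hcard hle) (hA.isConjStable_quotient hcard hle)
    exact .inr ⟨D, (hA.isomorphic_inducedAlgebra M).trans hD, D.elementary⟩
  · have : Finite Γ := hB.finite_of_faithfulSMul (AdjoinI k) Γ
    have hle := hB.card_le_card (AdjoinI k) Γ
    obtain ⟨D, hD, hN⟩ := hB.exists_semiRealTorsorDatum Γ
      (hA.card_stabilizer_le_card_equivariantAut_quotient hcard)
      (hA.stabilizer_normal hcard hle) (hA.isConjStable_quotient hcard hle)
    exact .inl ⟨D, (hA.isomorphic_inducedAlgebra M).trans hD, hN⟩
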